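/- Let $\mathrm{Homeo}(\mathbb{R})$ be the group of homeomorphisms of the real line, and let $G\le \mathrm{Homeo}(\mathbb{R})$ be a subgroup in which every non-trivial element has at most $2$ fixed points. Let $G_+\le G$ be the subgroup of orientation-preserving (that is, increasing) elements of $G$. Then at least one of the following holds: 1. $G_+$ is abelian, and every fixed point of a non-trivial element of $G_+$ is a global fixed point of $G_+$ (that is, it is fixed by every element of $G_+$); or 2. the action of $G$ is semi-conjugate to an action by affine transformations. That is, there exist a group $F\le\mathrm{Homeo}(\mathbb{R})$ all of whose elements are of the form $x\mapsto ax+b$ with $a,b\in\mathbb{R}$, $a\ne 0$, a surjective group homomorphism $\theta:G\to F$, and a continuous non-decreasing map $h:\mathbb{R}\to\mathbb{R}$ with $\lim_{x\to+\infty}h(x)=+\infty$ and $\lim_{x\to-\infty}h(x)=-\infty$, such that $\theta(g)(h(x))=h(g(x))$ for all $g\in G$ and $x\in\mathbb{R}$. -/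

import Mathlib

open Filter Topology

/-- A group of homeomorphisms of `X` has at most `N` fixed points if every non-trivial element of
the group has at most `N` fixed points. -/
def HasAtMostFixedPoints {X : Type*} [TopologicalSpace X] (G : Subgroup (X ≃ₜ X)) (N : ℕ) : Prop :=
  ∀ g ∈ G, g ≠ 1 → (Function.fixedPoints g).encard ≤ N

/-- The group of orientation-preserving homeomorphisms of the real line. -/
def homeoPlus : Subgroup (ℝ ≃ₜ ℝ) where
  carrier := {g | StrictMono g}
  mul_mem' := fun {_ _} hf hg => hf.comp hg
  one_mem' := strictMono_id
  inv_mem' := fun {f} hf x y hxy => by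
    by_contra! hle
    have h := hf.monotone hle
    rw [show f ((f⁻¹ : ℝ ≃ₜ ℝ) y) = y from f.apply_symm_apply y,
      show f ((f⁻¹ : ℝ ≃ₜ ℝ) x) = x from f.apply_symm_apply x] at h
    exact absurd hxy (not_lt.mpr h)

/-- The subgroup `G₊` of orientation-preserving elements of `G`. -/
def orientationPreserving (G : Subgroup (ℝ ≃ₜ ℝ)) : Subgroup (ℝ ≃ₜ ℝ) :=
  G ⊓ homeoPlus

/-- `x` is a global fixed point of `G`. -/
def IsGlobalFixedPoint {X : Type*} [TopologicalSpace X] (G : Subgroup (X ≃ₜ X)) (x : X) : Prop :=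
  ∀ g ∈ G, g x = x

/-- A monotone proper map of the real line: a non-decreasing map tending to `±∞` at `±∞`. -/
def IsMonotoneProper (h : ℝ → ℝ) : Prop :=
  Monotone h ∧ Tendsto h atTop atTop ∧ Tendsto h atBot atBot

/-- The action of `G` on the line is (positively) semi-conjugate to `F`: there are a surjective
morphism `θ : G → F` and a continuous monotone proper map `h` with `θ(g) ∘ h = h ∘ g`. -/
def IsSemiconjugateTo (G F : Subgroup (ℝ ≃ₜ ℝ)) : Prop :=
  ∃ (θ : G →* F) (h : ℝ → ℝ), Function.Surjective θ ∧ Continuous h ∧ IsMonotoneProper h ∧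
    ∀ (g : G) (x : ℝ), (θ g : ℝ ≃ₜ ℝ) (h x) = h ((g : ℝ ≃ₜ ℝ) x)

/-- `f` is an affine transformation `x ↦ a x + b` of the real line, `a ≠ 0`. -/
def IsAffineTransformation (f : ℝ ≃ₜ ℝ) : Prop :=
  ∃ a b : ℝ, a ≠ 0 ∧ ∀ x : ℝ, f x = a * x + b

/-! A non-trivial element of `G₊` has finitely many fixed points, hence a definite sign near `+∞`
and another near `-∞`; each end thus puts a bi-invariant order on `G₊`. In a bi-ordered group, if
`g` lies between powers of `f > 1`, the commutator of `f` and `g` is infinitesimal relative to `f`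
(`commutator_zpow_lt`). Such inequalities between germs at infinity are played against the dynamics
at finite points: a displacement changing sign three times has three fixed points, which is
forbidden.

Suppose `G₊` is not abelian. Free actions are commutative (`commute_of_free`), and so are actions
with a global fixed point (`commute_of_global`). Hence there is no global fixed point, but some
non-trivial element fixes a point. Hyperbolic elements would create a global fixed point, so an
element positive at both ends is positive everywhere (`lt_of_pos`). It follows that the
fixed-point-free elements together with `1` form a subgroup `N` (`isTranslation_mul`), and `N` is
non-trivial (`exists_free`).

`N` is normal in `G` and acts freely, so Hölder's theorem gives it faithful translation numbers.
Conjugating by an element with a fixed point shortens translations, so these numbers are dense, and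
the map `h` conjugating `N` to translations is unique up to an additive constant. Elements of `G`
rescale the translation numbers, so uniqueness forces `h ∘ g` to be an affine function of `h`
(`isSemiconjugateTo_affine`). -/

section OrderedGroup

/-! ### Commutators in bi-ordered groups -/

variable {Γ : Type*} [Group Γ]

section Order

variable [LinearOrder Γ] [MulLeftMono Γ] [MulRightMono Γ]

theorem pow_mul_pow_le_pow_mul_swap {a b : Γ} (h : b * a ≤ a * b) (n : ℕ) :
    b ^ n * a ^ n ≤ (b * a) ^ n := by
  induction n with
  | zero => simp
  | succ n ih =>
    calc b ^ (n + 1) * a ^ (n + 1) = b * (b ^ n * a ^ n) * a := by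
          simp only [pow_succ' b, pow_succ a, mul_assoc]
      _ ≤ b * (b * a) ^ n * a := by gcongr
      _ ≤ b * (a * b) ^ n * a := by gcongr
      _ = (b * a) ^ (n + 1) := by rw [← mul_pow_mul b a n, pow_succ, mul_assoc]

/-- In a bi-ordered group, commutators with `f` are infinitesimal relative to `f`. -/
theorem commutator_pow_lt {f g : Γ} (hf : 1 < f) {N : ℕ} (h1 : (f ^ N)⁻¹ ≤ g) (h2 : g ≤ f ^ N)
    (j : ℕ) : (f * g * f⁻¹ * g⁻¹) ^ j < f := by
  set c := f * g * f⁻¹ * g⁻¹ with hc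
  by_contra! hj
  have hff : f = c * (g * f * g⁻¹) := by rw [hc]; group
  -- If `f ≤ c ^ j`, then `c ^ k` is at least `f ^ (2 * N + 1)`: a factor `2 * N` pays for
  -- conjugating by `g`, and one extra `f` gives the contradiction `f ^ (k + 1) ≤ f ^ k`.
  set k := j * (2 * N + 1) with hk
  have hck : f ^ (2 * N + 1) ≤ c ^ k := by
    rw [hk, pow_mul]
    exact pow_le_pow_left' hj _
  have hfk : (f ^ N)⁻¹ * f ^ k * (f ^ N)⁻¹ ≤ (g * f * g⁻¹) ^ k := by
    rw [conj_pow]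
    have : (f ^ N)⁻¹ ≤ g⁻¹ := inv_le_inv_iff.mpr h2
    gcongr
  have hlt : f ^ k < f ^ (k + 1) := pow_lt_pow_right' hf (Nat.lt_succ_self k)
  refine absurd hlt (not_lt.mpr ?_)
  rcases le_total ((g * f * g⁻¹) * c) (c * (g * f * g⁻¹)) with h | h
  · calc f ^ (k + 1) = ((f ^ N)⁻¹ * f ^ k * (f ^ N)⁻¹) * f ^ (2 * N + 1) := by group
      _ ≤ (g * f * g⁻¹) ^ k * c ^ k := by gcongr
      _ ≤ ((g * f * g⁻¹) * c) ^ k := pow_mul_pow_le_pow_mul_swap h k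
      _ ≤ (c * (g * f * g⁻¹)) ^ k := pow_le_pow_left' h k
      _ = f ^ k := by rw [← hff]
  · calc f ^ (k + 1) = f ^ (2 * N + 1) * ((f ^ N)⁻¹ * f ^ k * (f ^ N)⁻¹) := by group
      _ ≤ c ^ k * (g * f * g⁻¹) ^ k := by gcongr
      _ ≤ (c * (g * f * g⁻¹)) ^ k := pow_mul_pow_le_pow_mul_swap h k
      _ = f ^ k := by rw [← hff]

/-- For negative exponents, the inverse commutator is conjugate by `g` to the commutator of `f` with
`g⁻¹`. The conjugation costs at most a factor `f ^ (2 * N)`, absorbed by raising to the power `2 * N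
+ 1`. -/
theorem commutator_zpow_lt {f g : Γ} (hf : 1 < f) {N : ℕ} (h1 : (f ^ N)⁻¹ ≤ g) (h2 : g ≤ f ^ N)
    (j : ℤ) : (f * g * f⁻¹ * g⁻¹) ^ j < f := by
  obtain ⟨n, rfl | rfl⟩ := j.eq_nat_or_neg
  · simpa using commutator_pow_lt hf h1 h2 n
  · by_contra! hcon
    set c := f * g * f⁻¹ * g⁻¹ with hc
    have hle : f ^ (2 * N + 1) ≤ (c ^ (-(n : ℤ))) ^ (2 * N + 1) := pow_le_pow_left' hcon _
    have hinv : c⁻¹ = g * (f * g⁻¹ * f⁻¹ * (g⁻¹)⁻¹) * g⁻¹ := by rw [hc]; group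
    have h3 : (f ^ N)⁻¹ ≤ g⁻¹ := inv_le_inv_iff.mpr h2
    have h4 : g⁻¹ ≤ f ^ N := inv_le'.mpr h1
    have hlt := commutator_pow_lt hf h3 h4 (n * (2 * N + 1))
    have : (c ^ (-(n : ℤ))) ^ (2 * N + 1) < f ^ (2 * N + 1) := by
      calc (c ^ (-(n : ℤ))) ^ (2 * N + 1)
          = (c⁻¹) ^ (n * (2 * N + 1)) := by rw [zpow_neg, zpow_natCast, pow_mul, inv_pow c n]
        _ = g * (f * g⁻¹ * f⁻¹ * (g⁻¹)⁻¹) ^ (n * (2 * N + 1)) * g⁻¹ := by rw [hinv, conj_pow]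
        _ < g * f * g⁻¹ := by gcongr
        _ ≤ f ^ N * f * f ^ N := by gcongr
        _ = f ^ (2 * N + 1) := by group
    exact absurd this (not_lt.mpr hle)

end Order

/-- The positive cone of a bi-invariant total order. -/
structure IsPositiveCone (P : Γ → Prop) : Prop where
  mul : ∀ {a b}, P a → P b → P (a * b)
  conj : ∀ {a} b, P a → P (b * a * b⁻¹)
  tri : ∀ a, a = 1 ∨ P a ∨ P a⁻¹
  not_one : ¬ P 1

namespace IsPositiveCone

variable {P : Γ → Prop}

theorem not_inv (hP : IsPositiveCone P) {a : Γ} (h : P a) : ¬ P a⁻¹ := fun h' =>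
  hP.not_one (by simpa using hP.mul h h')

theorem ne_one (hP : IsPositiveCone P) {a : Γ} (h : P a) : a ≠ 1 := fun h' =>
  hP.not_one (h' ▸ h)

theorem pow (hP : IsPositiveCone P) {a : Γ} (h : P a) {n : ℕ} (hn : n ≠ 0) : P (a ^ n) := by
  induction n with
  | zero => exact absurd rfl hn
  | succ n ih =>
    rcases eq_or_ne n 0 with rfl | hn'
    · simpa using h
    · rw [pow_succ]; exact hP.mul (ih hn') h

theorem conj_iff (hP : IsPositiveCone P) {a : Γ} (b : Γ) : P (b * a * b⁻¹) ↔ P a :=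
  ⟨fun h => by simpa [mul_assoc] using hP.conj b⁻¹ h, hP.conj b⟩

theorem mul_comm_iff (hP : IsPositiveCone P) {a b : Γ} : P (a * b) ↔ P (b * a) := by
  rw [← hP.conj_iff b]; simp [mul_assoc]

theorem lt_trans (hP : IsPositiveCone P) {a b c : Γ} (h : P (a⁻¹ * b)) (h' : P (b⁻¹ * c)) :
    P (a⁻¹ * c) := by
  simpa [mul_assoc] using hP.mul h h'

/-- The bi-invariant linear order attached to a positive cone. -/
noncomputable abbrev linearOrder (hP : IsPositiveCone P) : LinearOrder Γ where
  le a b := a = b ∨ P (a⁻¹ * b)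
  lt a b := P (a⁻¹ * b)
  le_refl a := Or.inl rfl
  le_trans a b c hab hbc := by
    rcases hab with rfl | hab
    · exact hbc
    · rcases hbc with rfl | hbc
      · exact Or.inr hab
      · exact Or.inr (hP.lt_trans hab hbc)
  lt_iff_le_not_ge a b := by
    constructor
    · intro h
      refine ⟨Or.inr h, ?_⟩
      rintro (rfl | h')
      · exact hP.not_one (by simpa using h)
      · exact hP.not_inv h (by simpa using h')
    · rintro ⟨rfl | h, h'⟩
      · exact absurd (Or.inl rfl) h'
      · exact h
  le_antisymm a b hab hba := by
    rcases hab with rfl | hab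
    · rfl
    · rcases hba with rfl | hba
      · rfl
      · exact absurd (by simpa using hba) (hP.not_inv hab)
  le_total a b := by
    rcases hP.tri (a⁻¹ * b) with h | h | h
    · exact Or.inl (Or.inl (inv_mul_eq_one.mp h))
    · exact Or.inl (Or.inr h)
    · exact Or.inr (Or.inr (by simpa using h))
  toDecidableLE := Classical.decRel _

theorem commutator_lt (hP : IsPositiveCone P) {f g : Γ} (hf : P f) {N : ℕ}
    (h1 : ¬ P (g⁻¹ * (f ^ N)⁻¹)) (h2 : ¬ P ((f ^ N)⁻¹ * g)) (j : ℤ) :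
    P (((f * g * f⁻¹ * g⁻¹) ^ j)⁻¹ * f) := by
  let _ := hP.linearOrder
  have : MulLeftMono Γ := ⟨fun a b c h => by
    rcases h with rfl | h
    · exact le_rfl
    · exact Or.inr (by simpa [mul_assoc] using h)⟩
  have : MulRightMono Γ := ⟨fun a b c h => by
    rcases h with rfl | h
    · exact le_rfl
    · exact Or.inr (by simpa [mul_assoc, Function.swap] using hP.conj a⁻¹ h)⟩
  exact commutator_zpow_lt (f := f) (g := g) (N := N)
    (show P (1⁻¹ * f) by simpa using hf) (not_lt.mp h1) (not_lt.mp h2) j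

end IsPositiveCone

end OrderedGroup

/-- Every non-empty set bounded above has a least upper bound. -/
class IsDedekindComplete (X : Type*) [LinearOrder X] : Prop where
  exists_isLUB : ∀ s : Set X, s.Nonempty → BddAbove s → ∃ a, IsLUB s a

instance : IsDedekindComplete ℝ where
  exists_isLUB s hs hb := ⟨sSup s, isLUB_csSup hs hb⟩

/-- Passing to the dual turns each statement about `+∞` into one about `-∞`; the next instance lets
results for lines be applied to the ray above a global fixed point. -/
instance (X : Type*) [LinearOrder X] [IsDedekindComplete X] : IsDedekindComplete Xᵒᵈ where
  exists_isLUB s hs hb := by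
    obtain ⟨b, hb⟩ := hb
    obtain ⟨x, hx⟩ := hs
    obtain ⟨a, ha⟩ := IsDedekindComplete.exists_isLUB
      {y : X | ∀ z : Xᵒᵈ, z ∈ s → y ≤ OrderDual.ofDual z} ⟨OrderDual.ofDual b, fun z hz => hb hz⟩
      ⟨OrderDual.ofDual x, fun y hy => hy x hx⟩
    exact ⟨OrderDual.toDual a, fun z hz => ha.2 (fun y hy => hy z hz),
      fun z hz => ha.1 (fun w hw => hz hw)⟩

instance (X : Type*) [LinearOrder X] [IsDedekindComplete X] (p : X) :
    IsDedekindComplete (Set.Ioi p) where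
  exists_isLUB s hs hb := by
    obtain ⟨b, hb⟩ := hb
    obtain ⟨a, ha⟩ := IsDedekindComplete.exists_isLUB (Subtype.val '' s) (hs.image _)
      ⟨b, by rintro _ ⟨x, hx, rfl⟩; exact hb hx⟩
    obtain ⟨x, hx⟩ := hs
    have hxa : (x : X) ≤ a := ha.1 ⟨x, hx, rfl⟩
    refine ⟨⟨a, lt_of_lt_of_le x.2 hxa⟩, fun y hy => ha.1 ⟨y, hy, rfl⟩, fun y hy => ?_⟩
    exact ha.2 (by rintro _ ⟨z, hz, rfl⟩; exact hy hz)

/-! ### Order-preserving actions: displacement signs, fixed points and orders at the ends -/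

namespace OrderAction

variable {Γ X : Type*} [Group Γ] [LinearOrder X] (ρ : Γ →* (X ≃o X))

@[simp] theorem apply_mul (g h : Γ) (x : X) : ρ (g * h) x = ρ g (ρ h x) := by
  rw [map_mul]; rfl

@[simp] theorem apply_one (x : X) : ρ 1 x = x := by
  rw [map_one]; rfl

@[simp] theorem apply_inv_apply (g : Γ) (x : X) : ρ g⁻¹ (ρ g x) = x := by
  rw [← apply_mul]; simp

@[simp] theorem apply_apply_inv (g : Γ) (x : X) : ρ g (ρ g⁻¹ x) = x := by
  rw [← apply_mul]; simp

theorem inv_lt_iff {g : Γ} {x y : X} : ρ g⁻¹ x < y ↔ x < ρ g y := by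
  rw [← (ρ g).lt_iff_lt, apply_apply_inv]

theorem lt_inv_iff {g : Γ} {x y : X} : x < ρ g⁻¹ y ↔ ρ g x < y := by
  rw [← (ρ g).lt_iff_lt, apply_apply_inv]

theorem inv_eq_iff {g : Γ} {x y : X} : ρ g⁻¹ x = y ↔ x = ρ g y := by
  rw [← (ρ g).injective.eq_iff, apply_apply_inv]

theorem inv_fixed {g : Γ} {x : X} (h : ρ g x = x) : ρ g⁻¹ x = x :=
  (inv_eq_iff ρ).mpr h.symm

theorem pow_fixed {g : Γ} {x : X} (h : ρ g x = x) (n : ℕ) : ρ (g ^ n) x = x := by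
  induction n with
  | zero => simp
  | succ n ih => rw [pow_succ, apply_mul, h, ih]

theorem pow_mono {g : Γ} {x : X} (h : x ≤ ρ g x) {m n : ℕ} (hmn : m ≤ n) :
    ρ (g ^ m) x ≤ ρ (g ^ n) x := by
  induction n, hmn using Nat.le_induction with
  | base => exact le_rfl
  | succ n _ ih =>
    refine ih.trans ?_
    rw [pow_succ, apply_mul]
    exact (ρ (g ^ n)).monotone h

theorem lt_pow {g : Γ} {x : X} (h : x < ρ g x) {n : ℕ} (hn : n ≠ 0) : x < ρ (g ^ n) x := by
  refine h.trans_le ?_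
  simpa using pow_mono ρ h.le (Nat.one_le_iff_ne_zero.mpr hn)

/-- The action on the order dual. -/
def dual : Γ →* (Xᵒᵈ ≃o Xᵒᵈ) where
  toFun g := (ρ g).dual
  map_one' := by ext x; exact apply_one ρ x
  map_mul' g h := by ext x; exact apply_mul ρ g h x

@[simp] theorem dual_apply (g : Γ) (x : X) :
    dual ρ g (OrderDual.toDual x) = OrderDual.toDual (ρ g x) := rfl

theorem pow_lt {g : Γ} {x : X} (h : ρ g x < x) {n : ℕ} (hn : n ≠ 0) : ρ (g ^ n) x < x :=
  lt_pow (dual ρ) (x := OrderDual.toDual x) h hn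

section Complete

variable [IsDedekindComplete X]

theorem exists_isLUB_orbit_fixed {g : Γ} {x y : X} (h : x ≤ ρ g x)
    (hy : ∀ n : ℕ, ρ (g ^ n) x ≤ y) : ∃ z, x ≤ z ∧ z ≤ y ∧ ρ g z = z := by
  obtain ⟨z, hz⟩ := IsDedekindComplete.exists_isLUB (Set.range fun n : ℕ => ρ (g ^ n) x)
    (Set.range_nonempty _) ⟨y, by rintro _ ⟨n, rfl⟩; exact hy n⟩
  refine ⟨z, ?_, hz.2 (by rintro _ ⟨n, rfl⟩; exact hy n), le_antisymm ?_ ?_⟩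
  · simpa using hz.1 ⟨0, rfl⟩
  · rw [← not_lt, ← inv_lt_iff]
    intro hlt
    refine absurd hlt (not_lt.mpr (hz.2 ?_))
    rintro _ ⟨n, rfl⟩
    rw [← not_lt, inv_lt_iff, not_lt]
    have := hz.1 ⟨n + 1, rfl⟩
    simpa only [pow_succ', apply_mul] using this
  · refine hz.2 ?_
    rintro _ ⟨n, rfl⟩
    refine (pow_mono ρ h n.le_succ).trans ?_
    rw [pow_succ', apply_mul]
    exact (ρ g).monotone (hz.1 ⟨n, rfl⟩)

theorem exists_pow_gt {g : Γ} {x y : X} (hxy : x ≤ y) (h : ∀ z, x ≤ z → z ≤ y → z < ρ g z) :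
    ∃ n : ℕ, ∀ m ≥ n, y < ρ (g ^ m) x := by
  have hx := h x le_rfl hxy
  by_contra! hcon
  obtain ⟨z, h1, h2, h3⟩ := exists_isLUB_orbit_fixed ρ (g := g) (x := x) (y := y) hx.le (fun n => by
    obtain ⟨m, hm, hle⟩ := hcon n
    exact (pow_mono ρ hx.le hm).trans hle)
  exact absurd h3 (h z h1 h2).ne'

theorem exists_pow_lt {g : Γ} {x y : X} (hyx : y ≤ x) (h : ∀ z, y ≤ z → z ≤ x → ρ g z < z) :
    ∃ n : ℕ, ∀ m ≥ n, ρ (g ^ m) x < y := by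
  have := exists_pow_gt (dual ρ) (g := g) (x := OrderDual.toDual x) (y := OrderDual.toDual y)
    hyx (fun z h1 h2 => h (OrderDual.ofDual z) h2 h1)
  exact this

theorem exists_fixed_of_lt_of_gt {g : Γ} {x y : X} (hxy : x < y) (hx : x < ρ g x)
    (hy : ρ g y < y) : ∃ z, x < z ∧ z < y ∧ ρ g z = z := by
  obtain ⟨z, h1, h2, h3⟩ := exists_isLUB_orbit_fixed ρ (g := g) (x := x) (y := y) hx.le (fun n =>
    ((ρ (g ^ n)).monotone hxy.le).trans (by
      rcases eq_or_ne n 0 with rfl | hn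
      · simp
      · exact (pow_lt ρ hy hn).le))
  refine ⟨z, lt_of_le_of_ne h1 ?_, lt_of_le_of_ne h2 ?_, h3⟩
  · rintro rfl; exact absurd h3 hx.ne'
  · rintro rfl; exact absurd h3 hy.ne

theorem exists_fixed_of_gt_of_lt {g : Γ} {x y : X} (hxy : x < y) (hx : ρ g x < x)
    (hy : y < ρ g y) : ∃ z, x < z ∧ z < y ∧ ρ g z = z := by
  obtain ⟨z, h1, h2, h3⟩ := exists_fixed_of_lt_of_gt ρ (g := g⁻¹) hxy
    ((lt_inv_iff ρ).mpr hx) ((inv_lt_iff ρ).mpr hy)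
  exact ⟨z, h1, h2, by simpa using inv_fixed ρ h3⟩

/-- A displacement sign is constant on an interval without fixed points. -/
theorem lt_apply_of_forall_ne {g : Γ} {s : Set X} (hs : s.OrdConnected)
    (hne : ∀ z ∈ s, ρ g z ≠ z) {x y : X} (hx : x ∈ s) (hy : y ∈ s) (hxg : x < ρ g x) :
    y < ρ g y := by
  by_contra! hle
  have hlt : ρ g y < y := lt_of_le_of_ne hle (hne y hy)
  rcases lt_trichotomy x y with h | rfl | h
  · obtain ⟨z, h1, h2, h3⟩ := exists_fixed_of_lt_of_gt ρ h hxg hlt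
    exact hne z (hs.out hx hy ⟨h1.le, h2.le⟩) h3
  · exact absurd hxg hlt.not_gt
  · obtain ⟨z, h1, h2, h3⟩ := exists_fixed_of_gt_of_lt ρ h hlt hxg
    exact hne z (hs.out hy hx ⟨h1.le, h2.le⟩) h3

theorem apply_lt_of_forall_ne {g : Γ} {s : Set X} (hs : s.OrdConnected)
    (hne : ∀ z ∈ s, ρ g z ≠ z) {x y : X} (hx : x ∈ s) (hy : y ∈ s) (hxg : ρ g x < x) :
    ρ g y < y := by
  by_contra! hle
  have hlt : y < ρ g y := lt_of_le_of_ne hle (hne y hy).symm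
  exact absurd (lt_apply_of_forall_ne ρ hs hne hy hx hlt) hxg.not_gt

end Complete

/-- Every non-trivial element has at most `2` fixed points. -/
def AtMostTwoFixed : Prop := ∀ g : Γ, g ≠ 1 → (Function.fixedPoints (ρ g)).encard ≤ 2

variable {ρ}

theorem AtMostTwoFixed.dual (hρ : AtMostTwoFixed ρ) : AtMostTwoFixed (dual ρ) := hρ

theorem AtMostTwoFixed.finite (hρ : AtMostTwoFixed ρ) {g : Γ} (hg : g ≠ 1) :
    (Function.fixedPoints (ρ g)).Finite :=
  Set.finite_of_encard_le_coe (k := 2) (hρ g hg)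

theorem AtMostTwoFixed.eq_one (hρ : AtMostTwoFixed ρ) {g : Γ} {x y z : X} (hxy : x < y)
    (hyz : y < z) (hx : ρ g x = x) (hy : ρ g y = y) (hz : ρ g z = z) : g = 1 := by
  by_contra hg
  have h3 : ({x, y, z} : Set X).encard = 3 :=
    Set.encard_eq_three.mpr ⟨x, y, z, hxy.ne, (hxy.trans hyz).ne, hyz.ne, rfl⟩
  have hle : ({x, y, z} : Set X).encard ≤ 2 := (Set.encard_le_encard (by
    rintro w (rfl | rfl | rfl) <;> assumption)).trans (hρ g hg)
  rw [h3] at hle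
  exact absurd hle (by decide)

theorem ne_one_of_lt {g : Γ} {x : X} (h : x < ρ g x) : g ≠ 1 := by
  rintro rfl; simp at h

/-- Each sign change of the displacement produces a fixed point, and three are too many. -/
theorem AtMostTwoFixed.not_alternating (hρ : AtMostTwoFixed ρ) [IsDedekindComplete X] {g : Γ}
    {x₀ x₁ x₂ x₃ : X} (h01 : x₀ < x₁) (h12 : x₁ < x₂) (h23 : x₂ < x₃) (h0 : ρ g x₀ < x₀)
    (h1 : x₁ < ρ g x₁) (h2 : ρ g x₂ < x₂) (h3 : x₃ < ρ g x₃) : False := by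
  obtain ⟨a, a1, a2, a3⟩ := exists_fixed_of_gt_of_lt ρ h01 h0 h1
  obtain ⟨b, b1, b2, b3⟩ := exists_fixed_of_lt_of_gt ρ h12 h1 h2
  obtain ⟨c, c1, c2, c3⟩ := exists_fixed_of_gt_of_lt ρ h23 h2 h3
  exact ne_one_of_lt h1 (hρ.eq_one (a2.trans b1) (b2.trans c1) a3 b3 c3)

theorem AtMostTwoFixed.not_alternating' (hρ : AtMostTwoFixed ρ) [IsDedekindComplete X] {g : Γ}
    {x₀ x₁ x₂ x₃ : X} (h01 : x₀ < x₁) (h12 : x₁ < x₂) (h23 : x₂ < x₃) (h0 : x₀ < ρ g x₀)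
    (h1 : ρ g x₁ < x₁) (h2 : x₂ < ρ g x₂) (h3 : ρ g x₃ < x₃) : False :=
  hρ.not_alternating (g := g⁻¹) h01 h12 h23 ((inv_lt_iff ρ).mpr h0) ((lt_inv_iff ρ).mpr h1)
    ((inv_lt_iff ρ).mpr h2) ((lt_inv_iff ρ).mpr h3)

variable (ρ)

/-- `g` moves points to the right near `+∞`. -/
def PosTop (g : Γ) : Prop := ∀ᶠ x in atTop, x < ρ g x

/-- `g` moves points to the right near `-∞`. -/
def PosBot (g : Γ) : Prop := ∀ᶠ x in atBot, x < ρ g x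

theorem posTop_dual {g : Γ} : PosTop (dual ρ) g ↔ ∀ᶠ x in atBot, ρ g x < x := Iff.rfl

theorem tendsto_atTop (g : Γ) : Tendsto (ρ g) atTop atTop := (ρ g).tendsto_atTop

theorem tendsto_atBot (g : Γ) : Tendsto (ρ g) atBot atBot := (ρ g).tendsto_atBot

theorem posTop_inv {g : Γ} : PosTop ρ g⁻¹ ↔ ∀ᶠ x in atTop, ρ g x < x := by
  simp only [PosTop, lt_inv_iff]

theorem posBot_inv {g : Γ} : PosBot ρ g⁻¹ ↔ ∀ᶠ x in atBot, ρ g x < x := by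
  simp only [PosBot, lt_inv_iff]

theorem posTop_dual_inv {g : Γ} : PosTop (dual ρ) g⁻¹ ↔ PosBot ρ g := by
  rw [posTop_dual, ← posBot_inv, inv_inv]

theorem posBot_dual_inv {g : Γ} : PosBot (dual ρ) g⁻¹ ↔ PosTop ρ g := by
  rw [posBot_inv]; exact Iff.rfl

section Ends

variable {ρ} [Nonempty X] [NoMaxOrder X] [IsDedekindComplete X]

theorem AtMostTwoFixed.posTop_or (hρ : AtMostTwoFixed ρ) {g : Γ} (hg : g ≠ 1) :
    PosTop ρ g ∨ PosTop ρ g⁻¹ := by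
  obtain ⟨M, hM⟩ := (hρ.finite hg).bddAbove
  obtain ⟨y, hy⟩ := exists_gt M
  have hne : ∀ z ∈ Set.Ici y, ρ g z ≠ z := fun z hz h =>
    absurd (hM (show z ∈ Function.fixedPoints (ρ g) from h)) (not_le.mpr (hy.trans_le hz))
  rcases lt_or_gt_of_ne (hne y Set.self_mem_Ici) with h | h
  · right
    rw [posTop_inv]
    filter_upwards [eventually_ge_atTop y] with z hz
    exact apply_lt_of_forall_ne ρ Set.ordConnected_Ici hne Set.self_mem_Ici hz h
  · left
    filter_upwards [eventually_ge_atTop y] with z hz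
    exact lt_apply_of_forall_ne ρ Set.ordConnected_Ici hne Set.self_mem_Ici hz h

theorem AtMostTwoFixed.isPositiveCone_posTop (hρ : AtMostTwoFixed ρ) :
    IsPositiveCone (PosTop ρ) where
  mul := fun {a b} ha hb => by
    filter_upwards [hb, (tendsto_atTop ρ b).eventually ha] with x h1 h2
    rw [apply_mul]; exact h1.trans h2
  conj := fun {a} b ha => by
    filter_upwards [(tendsto_atTop ρ b⁻¹).eventually ha] with x h1
    rw [apply_mul, apply_mul]
    simpa using (ρ b).strictMono h1
  tri a := by
    by_cases ha : a = 1
    · exact Or.inl ha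
    · exact Or.inr (hρ.posTop_or ha)
  not_one h := by
    obtain ⟨x, hx⟩ := h.exists
    simp at hx

end Ends

theorem AtMostTwoFixed.isPositiveCone_posBot {ρ : Γ →* (X ≃o X)} [Nonempty X] [NoMinOrder X]
    [IsDedekindComplete X] (hρ : AtMostTwoFixed ρ) : IsPositiveCone (PosBot ρ) where
  mul := fun {a b} ha hb => by
    filter_upwards [hb, (tendsto_atBot ρ b).eventually ha] with x h1 h2
    rw [apply_mul]; exact h1.trans h2
  conj := fun {a} b ha => by
    filter_upwards [(tendsto_atBot ρ b⁻¹).eventually ha] with x h1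
    rw [apply_mul, apply_mul]
    simpa using (ρ b).strictMono h1
  tri a := by
    have h := hρ.dual.isPositiveCone_posTop.tri a⁻¹
    rw [posTop_dual_inv, posTop_dual_inv, inv_eq_one] at h
    exact h
  not_one h := by
    obtain ⟨x, hx⟩ := h.exists
    simp at hx

end OrderAction

/-! ### Hyperbolic elements -/

namespace OrderAction

variable {Γ X : Type*} [Group Γ] [LinearOrder X] (ρ : Γ →* (X ≃o X))

/-- `w` fixes `a < b`, moves the points of `(a, b)` to the right and the points outside `[a, b]` to
the left. -/
structure IsHyperbolic (w : Γ) (a b : X) : Prop where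
  lt : a < b
  left_fixed : ρ w a = a
  right_fixed : ρ w b = b
  left : ∀ x, x < a → ρ w x < x
  mid : ∀ x, a < x → x < b → x < ρ w x
  right : ∀ x, b < x → ρ w x < x

variable {ρ}

theorem IsHyperbolic.conj {w : Γ} {a b : X} (h : IsHyperbolic ρ w a b) (k : Γ) :
    IsHyperbolic ρ (k * w * k⁻¹) (ρ k a) (ρ k b) where
  lt := (ρ k).strictMono h.lt
  left_fixed := by simp [h.left_fixed]
  right_fixed := by simp [h.right_fixed]
  left x hx := by
    rw [apply_mul, apply_mul, ← lt_inv_iff]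
    exact h.left _ ((inv_lt_iff ρ).mpr hx)
  mid x hx hx' := by
    rw [apply_mul, apply_mul, ← inv_lt_iff]
    exact h.mid _ ((lt_inv_iff ρ).mpr hx) ((inv_lt_iff ρ).mpr hx')
  right x hx := by
    rw [apply_mul, apply_mul, ← lt_inv_iff]
    exact h.right _ ((lt_inv_iff ρ).mpr hx)

variable [IsDedekindComplete X]

theorem AtMostTwoFixed.isHyperbolic (hρ : AtMostTwoFixed ρ) {w : Γ} {x y z : X} (hxy : x < y)
    (hyz : y < z) (hx : ρ w x < x) (hy : y < ρ w y) (hz : ρ w z < z) :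
    ∃ a b, IsHyperbolic ρ w a b := by
  obtain ⟨a, a1, a2, a3⟩ := exists_fixed_of_gt_of_lt ρ hxy hx hy
  obtain ⟨b, b1, b2, b3⟩ := exists_fixed_of_lt_of_gt ρ hyz hy hz
  have hw := ne_one_of_lt hy
  refine ⟨a, b, a2.trans b1, a3, b3, fun u hu => ?_, fun u hu hu' => ?_, fun u hu => ?_⟩
  · exact apply_lt_of_forall_ne ρ (s := Set.Iio a) Set.ordConnected_Iio
      (fun v hv h => hw (hρ.eq_one hv (a2.trans b1) h a3 b3)) a1 hu hx
  · exact lt_apply_of_forall_ne ρ (s := Set.Ioo a b) Set.ordConnected_Ioo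
      (fun v hv h => hw (hρ.eq_one hv.1 hv.2 a3 h b3)) ⟨a2, b1⟩ ⟨hu, hu'⟩ hy
  · exact apply_lt_of_forall_ne ρ (s := Set.Ioi b) Set.ordConnected_Ioi
      (fun v hv h => hw (hρ.eq_one (a2.trans b1) hv a3 b3 h)) b2 hu hz

variable [NoMaxOrder X] [NoMinOrder X] [DenselyOrdered X]

/-- Two hyperbolic elements cannot have disjoint axes. -/
theorem IsHyperbolic.not_disjoint (hρ : AtMostTwoFixed ρ) {w w' : Γ} {a b a' b' : X}
    (h : IsHyperbolic ρ w a b) (h' : IsHyperbolic ρ w' a' b') : ¬ b < a' := by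
  intro hba
  have : Nonempty X := ⟨a⟩
  have hP := hρ.isPositiveCone_posTop
  have hwb' : ρ w b' < b' := h.right _ (hba.trans h'.lt)
  obtain ⟨z₀, hz1, hz2⟩ := exists_between ((lt_inv_iff ρ).mpr hwb')
  -- A large power `g` of `w'` carries `b` below `a`, while `g⁻¹` carries `z₀` beyond `ρ w⁻¹ b'`.
  -- These two facts fix the signs of the commutator `c` below.
  obtain ⟨m₁, hm₁⟩ := exists_pow_lt ρ (g := w') h.lt.le
    (fun z _ hz => h'.left z (hz.trans_lt hba))
  obtain ⟨m₂, hm₂⟩ := exists_pow_gt ρ (g := w'⁻¹) (x := z₀) (y := ρ w⁻¹ b') hz2.le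
    (fun z hz _ => (lt_inv_iff ρ).mpr (h'.right z (hz1.trans_le hz)))
  set m := max (max m₁ m₂) 1 with hm
  have hm0 : m ≠ 0 := by positivity
  set g := w' ^ m with hg
  have hgb : ρ g b < a := hm₁ m ((le_max_left _ _).trans (le_max_left _ _))
  have hgz : ρ w⁻¹ b' < ρ g⁻¹ z₀ := by
    rw [hg, ← inv_pow]; exact hm₂ m ((le_max_right _ _).trans (le_max_left _ _))
  have hga' : ρ g a' = a' := pow_fixed ρ h'.left_fixed m
  have hgb' : ρ g b' = b' := pow_fixed ρ h'.right_fixed m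
  have hPg : PosTop ρ g⁻¹ := by
    rw [posTop_inv]
    filter_upwards [eventually_gt_atTop b'] with x hx
    exact pow_lt ρ (h'.right x hx) hm0
  have hPw : PosTop ρ w⁻¹ := by
    rw [posTop_inv]
    filter_upwards [eventually_gt_atTop b] with x hx
    exact h.right x hx
  -- In the order at `+∞`, `g⁻¹` is bounded by a power of `w⁻¹`: otherwise `g⁻¹ * w ^ n` would have
  -- signs `-, +, -, +` at a far left point, `b`, `a'` and a far right point.
  obtain ⟨n, hn0, hn⟩ : ∃ n : ℕ, n ≠ 0 ∧ ¬ PosTop ρ (g⁻¹ * w ^ n) := by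
    obtain ⟨y, hy⟩ := exists_lt a
    obtain ⟨n, hn⟩ := exists_pow_lt ρ (g := w) (min_le_left y (ρ g y))
      (fun z _ hz => h.left z (hz.trans_lt hy))
    refine ⟨max n 1, by positivity, fun hpos => ?_⟩
    obtain ⟨x, hx, hx'⟩ := (hpos.and (eventually_gt_atTop a')).exists
    refine hρ.not_alternating (g := g⁻¹ * w ^ (max n 1)) (hy.trans h.lt) hba hx' ?_ ?_ ?_ hx
    · rw [apply_mul, inv_lt_iff]
      exact (hn _ (le_max_left _ _)).trans_le (min_le_right _ _)
    · rw [apply_mul, lt_inv_iff, pow_fixed ρ h.right_fixed]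
      exact hgb.trans h.lt
    · rw [apply_mul, inv_lt_iff, hga']
      exact pow_lt ρ (h.right _ hba) (by positivity)
  set c := w⁻¹ * g * w * g⁻¹ with hc
  set β := ρ g b with hβ
  have hwβ : ρ w β < β := h.left _ hgb
  have hcβ : β < ρ c β := by
    simp only [hc, apply_mul, hβ, apply_inv_apply, h.right_fixed]
    exact (lt_inv_iff ρ).mpr hwβ
  have hca : ρ c a < a := by
    simp only [hc, apply_mul]
    rw [inv_lt_iff, h.left_fixed, ← lt_inv_iff]
    exact h.right _ ((lt_inv_iff ρ).mpr hgb)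
  have hcz : z₀ < ρ c z₀ := by
    simp only [hc, apply_mul]
    rw [lt_inv_iff]
    refine ((lt_inv_iff ρ).mp hz2).trans ?_
    rwa [← inv_lt_iff, inv_fixed ρ hgb', ← inv_lt_iff]
  have haz : a < z₀ := h.lt.trans (hba.trans (h'.lt.trans hz1))
  obtain ⟨p, hp1, hp2, hp3⟩ := exists_fixed_of_lt_of_gt ρ hgb hcβ hca
  obtain ⟨q, hq1, hq2, hq3⟩ := exists_fixed_of_gt_of_lt ρ haz hca hcz
  have hc1 := ne_one_of_lt hcβ
  have hcl : ∀ z ≤ β, z < ρ c z := fun z hz =>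
    lt_apply_of_forall_ne ρ (s := Set.Iic β) Set.ordConnected_Iic
      (fun v hv hv' => hc1 (hρ.eq_one (lt_of_le_of_lt hv hp1) (hp2.trans hq1) hv' hp3 hq3))
      (Set.self_mem_Iic) hz hcβ
  have hcr : ∀ z ≥ z₀, z < ρ c z := fun z hz =>
    lt_apply_of_forall_ne ρ (s := Set.Ici z₀) Set.ordConnected_Ici
      (fun v hv hv' => hc1 (hρ.eq_one (hp2.trans hq1) (lt_of_lt_of_le hq2 hv) hp3 hq3 hv'))
      (Set.self_mem_Ici) hz hcz
  have hwz : ρ w z₀ < z₀ := h.right _ (hba.trans (h'.lt.trans hz1))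
  have hwz' : z₀ < ρ w⁻¹ z₀ := (lt_inv_iff ρ).mpr hwz
  obtain ⟨j₁, hj₁⟩ := exists_pow_gt ρ (g := c) hwβ.le (fun z _ hz => hcl z hz)
  obtain ⟨j₂, hj₂⟩ := exists_pow_gt ρ (g := c) hwz'.le (fun z hz _ => hcr z hz)
  set j := max j₁ j₂
  -- `c` moves points right on both outer sides of its fixed points `p < q`, so for large `j` it
  -- beats `w` at `β` and at `ρ w⁻¹ z₀`, but at `p` only `w` acts. A negative sign at `+∞` would
  -- complete a forbidden alternation; yet `c` being infinitesimal relative to `w⁻¹` demands exactly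
  -- that sign.
  have hneg : ¬ PosTop ρ (c ^ j * w)⁻¹ := by
    intro hpos
    rw [posTop_inv] at hpos
    obtain ⟨x, hx, hx'⟩ := (hpos.and (eventually_gt_atTop (ρ w⁻¹ z₀))).exists
    refine hρ.not_alternating' (g := c ^ j * w) hp1 (hp2.trans (haz.trans hwz')) hx' ?_ ?_ ?_ hx
    · rw [apply_mul]; exact hj₁ j (le_max_left _ _)
    · rw [apply_mul]
      conv_rhs => rw [← pow_fixed ρ hp3 j]
      exact (ρ (c ^ j)).strictMono (h.left _ hp2)
    · rw [apply_mul, apply_apply_inv]; exact hj₂ j (le_max_right _ _)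
  apply hneg
  have key := hP.commutator_lt (f := w⁻¹) (g := g) hPw (N := n)
    (by simpa using hn)
    (by
      have := hP.not_inv (hP.mul hPg (hP.pow hPw hn0))
      rwa [mul_inv_rev, inv_inv] at this) j
  rw [hP.mul_comm_iff] at key
  rw [mul_inv_rev]
  simpa [hc] using key

/-- A hyperbolic element forces a global fixed point. -/
theorem IsHyperbolic.exists_global (hρ : AtMostTwoFixed ρ) {w : Γ} {a b : X}
    (h : IsHyperbolic ρ w a b) : ∃ p, ∀ g, ρ g p = p := by
  -- Conjugates of `w` never have disjoint axes, so the orbit of `a` lies below the orbit of `b`,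
  -- and its supremum is invariant.
  have hab : ∀ k l : Γ, ρ k a ≤ ρ l b := fun k l =>
    not_lt.mp (IsHyperbolic.not_disjoint hρ (h.conj l) (h.conj k))
  obtain ⟨p, hp⟩ := IsDedekindComplete.exists_isLUB (Set.range fun k : Γ => ρ k a)
    (Set.range_nonempty _) ⟨b, by rintro _ ⟨k, rfl⟩; simpa using hab k 1⟩
  have hle : ∀ g : Γ, p ≤ ρ g p := fun g => hp.2 (by
    rintro _ ⟨k, rfl⟩
    rw [← not_lt, ← lt_inv_iff, not_lt]
    exact hp.1 ⟨g⁻¹ * k, by simp⟩)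
  refine ⟨p, fun g => le_antisymm ?_ (hle g)⟩
  rw [← not_lt, ← inv_lt_iff, not_lt]
  exact hle g⁻¹

end OrderAction

/-! ### Fixed-point-free elements in the absence of global fixed points -/

namespace OrderAction

variable {Γ X : Type*} [Group Γ] [LinearOrder X] {ρ : Γ →* (X ≃o X)}

theorem not_lt_of_mapsTo_finite {s : Set X} (hs : s.Finite) {k : Γ}
    (hk : ∀ x ∈ s, ρ k x ∈ s) {x : X} (hx : x ∈ s) : ¬ x < ρ k x := fun h => by
  have hmem : ∀ n : ℕ, ρ (k ^ n) x ∈ s := fun n => by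
    induction n with
    | zero => simpa using hx
    | succ n ih => rw [pow_succ', apply_mul]; exact hk _ ih
  have hmono : StrictMono fun n : ℕ => ρ (k ^ n) x := strictMono_nat_of_lt_succ fun n => by
    rw [pow_succ, apply_mul]; exact (ρ (k ^ n)).strictMono h
  exact Set.infinite_of_injective_forall_mem hmono.injective hmem hs

/-- An increasing bijection preserving a finite set fixes it pointwise. -/
theorem fixed_of_mapsTo_finite {s : Set X} (hs : s.Finite) {k : Γ}
    (hk : ∀ x ∈ s, ρ k x ∈ s) {x : X} (hx : x ∈ s) : ρ k x = x :=
  le_antisymm (not_lt.mp (not_lt_of_mapsTo_finite hs hk hx))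
    (not_lt.mp (not_lt_of_mapsTo_finite (ρ := dual ρ) (X := Xᵒᵈ) (s := OrderDual.ofDual ⁻¹' s)
      hs hk (x := OrderDual.toDual x) hx)) |>.symm ▸ rfl

theorem AtMostTwoFixed.fixed_of_commute (hρ : AtMostTwoFixed ρ) {e k : Γ} (he : e ≠ 1)
    (hek : e * k = k * e) {x : X} (hx : ρ e x = x) : ρ k x = x :=
  fixed_of_mapsTo_finite (hρ.finite he) (fun y hy => by
    have hy' : ρ e y = y := hy
    show ρ e (ρ k y) = ρ k y
    rw [← apply_mul, hek, apply_mul, hy']) hx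

variable (ρ) in
/-- `g` is trivial or acts without fixed points. -/
def IsTranslation (g : Γ) : Prop := g = 1 ∨ ∀ x, ρ g x ≠ x

theorem isTranslation_inv {g : Γ} (hg : IsTranslation ρ g) : IsTranslation ρ g⁻¹ := by
  rcases hg with rfl | hg
  · exact Or.inl inv_one
  · exact Or.inr fun x hx => hg x (by simpa using inv_fixed ρ hx)

theorem isTranslation_conj {g : Γ} (hg : IsTranslation ρ g) (k : Γ) :
    IsTranslation ρ (k * g * k⁻¹) := by
  rcases hg with rfl | hg
  · exact Or.inl (by simp)
  · refine Or.inr fun x hx => hg (ρ k⁻¹ x) ?_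
    rw [eq_comm, inv_eq_iff, eq_comm]
    simpa using hx

section

variable [IsDedekindComplete X] [Nonempty X]

theorem lt_or_gt_of_free {g : Γ} (hg : ∀ x, ρ g x ≠ x) :
    (∀ x, x < ρ g x) ∨ (∀ x, ρ g x < x) := by
  obtain ⟨x⟩ := ‹Nonempty X›
  rcases lt_or_gt_of_ne (hg x) with h | h
  · exact Or.inr fun y => apply_lt_of_forall_ne ρ (s := Set.univ) Set.ordConnected_univ
      (fun z _ => hg z) trivial trivial h
  · exact Or.inl fun y => lt_apply_of_forall_ne ρ (s := Set.univ) Set.ordConnected_univ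
      (fun z _ => hg z) trivial trivial h

theorem pos_or_neg_of_free {g : Γ} (hg : ∀ x, ρ g x ≠ x) :
    (PosTop ρ g ∧ PosBot ρ g) ∨ (PosTop ρ g⁻¹ ∧ PosBot ρ g⁻¹) := by
  rw [posTop_inv, posBot_inv]
  rcases lt_or_gt_of_free hg with h | h
  · exact Or.inl ⟨.of_forall h, .of_forall h⟩
  · exact Or.inr ⟨.of_forall h, .of_forall h⟩

theorem exists_fixed_of_posTop [NoMinOrder X] {e : Γ} (ht : PosTop ρ e)
    (hb : PosBot ρ e⁻¹) : ∃ p, ρ e p = p := by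
  obtain ⟨r, hr⟩ := ht.exists
  obtain ⟨l, hl, hl'⟩ := (((posBot_inv ρ).mp hb).and (eventually_lt_atBot r)).exists
  obtain ⟨p, -, -, hp⟩ := exists_fixed_of_gt_of_lt ρ hl' hl hr
  exact ⟨p, hp⟩

end

variable [IsDedekindComplete X] [NoMinOrder X]

/-- For large `n`, the element `g⁻¹ ^ n * g'` moves far left points left since `g⁻¹ ^ n` wins there,
moves `x` right by `g'`, and moves `y` left by `g⁻¹`. -/
theorem AtMostTwoFixed.exists_isHyperbolic_of_le (hρ : AtMostTwoFixed ρ) {g g' : Γ}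
    (hg : ∀ x, x ≤ ρ g x) (hg' : ∀ x, x ≤ ρ g' x) {x y : X} (hxy : x < y) (hx : ρ g x = x)
    (hx' : ρ g' x ≠ x) (hy : ρ g y ≠ y) (hy' : ρ g' y = y) :
    ∃ w a b, IsHyperbolic ρ w a b := by
  have : Nonempty X := ⟨x⟩
  have hg1 : g ≠ 1 := by rintro rfl; simp at hy
  obtain ⟨m, hm⟩ := (hρ.finite hg1).bddBelow
  obtain ⟨z₀, hz₀⟩ := exists_lt m
  have hzx : z₀ < x := hz₀.trans_le (hm hx)
  have hz : ρ g'⁻¹ z₀ ≤ z₀ := by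
    rw [← not_lt, lt_inv_iff, not_lt]; exact hg' z₀
  obtain ⟨n, hn⟩ := exists_pow_lt ρ (g := g⁻¹) hz (fun u _ hu => (inv_lt_iff ρ).mpr
    (lt_of_le_of_ne (hg u) fun h => absurd (hm (show u ∈ Function.fixedPoints (ρ g) from h.symm))
      (not_le.mpr (hu.trans_lt hz₀))))
  obtain ⟨a, b, h⟩ := hρ.isHyperbolic (w := g⁻¹ ^ (max n 1) * g') (hz.trans_lt hzx) hxy
    (by rw [apply_mul, apply_apply_inv]; exact hn _ (le_max_left _ _))
    (by
      rw [apply_mul]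
      conv_lhs => rw [← pow_fixed ρ (inv_fixed ρ hx) (max n 1)]
      exact (ρ _).strictMono (lt_of_le_of_ne (hg' x) hx'.symm))
    (by
      rw [apply_mul, hy']
      exact pow_lt ρ ((inv_lt_iff ρ).mpr (lt_of_le_of_ne (hg y) hy.symm)) (by positivity))
  exact ⟨_, a, b, h⟩

/-- The fixed sets of `g` and of its conjugate by `k` are finite and `k` maps one onto the other. An
inclusion either way would make `k` fix `x`, so each contains a point outside the other. -/
theorem AtMostTwoFixed.exists_isHyperbolic_of_parabolic (hρ : AtMostTwoFixed ρ) {g k : Γ}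
    (hg1 : g ≠ 1) (hg : ∀ x, x ≤ ρ g x) {x : X} (hx : ρ g x = x) (hk : ρ k x ≠ x) :
    ∃ w a b, IsHyperbolic ρ w a b := by
  have hfin := hρ.finite hg1
  have hconj : ∀ y, y ≤ ρ (k * g * k⁻¹) y := fun y => by
    rw [apply_mul, apply_mul, ← not_lt, ← lt_inv_iff, not_lt]
    exact hg _
  have hfix : ∀ y, ρ (k * g * k⁻¹) y = y ↔ ρ g (ρ k⁻¹ y) = ρ k⁻¹ y := fun y => by
    rw [apply_mul, apply_mul, eq_comm (b := ρ k⁻¹ y), inv_eq_iff, eq_comm]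
  obtain ⟨u, hu, hu'⟩ : ∃ u, ρ g u = u ∧ ρ (k * g * k⁻¹) u ≠ u := by
    by_contra! hcon
    refine hk ?_
    have := fixed_of_mapsTo_finite hfin (k := k⁻¹) (fun y hy => (hfix y).mp (hcon y hy)) hx
    simpa using inv_fixed ρ this
  obtain ⟨v, hv, hv'⟩ : ∃ v, ρ (k * g * k⁻¹) v = v ∧ ρ g v ≠ v := by
    by_contra! hcon
    exact hk (fixed_of_mapsTo_finite hfin (k := k) (fun y hy => hcon _ ((hfix _).mpr (by
      rw [apply_inv_apply]; exact hy))) hx)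
  rcases lt_trichotomy u v with h | rfl | h
  · exact hρ.exists_isHyperbolic_of_le hg hconj h hu hu' hv' hv
  · exact absurd hu hv'
  · exact hρ.exists_isHyperbolic_of_le hconj hg h hv hv' hu' hu

variable [NoMaxOrder X] [DenselyOrdered X] [Nonempty X]

/-- Without global fixed points, an element which is positive at both ends is positive. -/
theorem AtMostTwoFixed.lt_of_pos (hρ : AtMostTwoFixed ρ) (hng : ∀ p, ∃ k, ρ k p ≠ p) {g : Γ}
    (ht : PosTop ρ g) (hb : PosBot ρ g) (x : X) : x < ρ g x := by
  have hnh : ∀ w a b, ¬ IsHyperbolic ρ w a b := fun w a b h => by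
    obtain ⟨p, hp⟩ := h.exists_global hρ
    obtain ⟨k, hk⟩ := hng p
    exact hk (hp k)
  have hle : ∀ y, y ≤ ρ g y := by
    by_contra! hcon
    obtain ⟨y, hy⟩ := hcon
    obtain ⟨l, hl, hl'⟩ := (hb.and (eventually_lt_atBot y)).exists
    obtain ⟨r, hr, hr'⟩ := (ht.and (eventually_gt_atTop y)).exists
    obtain ⟨a, b, h⟩ := hρ.isHyperbolic (w := g⁻¹) hl' hr' ((inv_lt_iff ρ).mpr hl)
      ((lt_inv_iff ρ).mpr hy) ((inv_lt_iff ρ).mpr hr)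
    exact hnh _ _ _ h
  refine lt_of_le_of_ne (hle x) fun hx => ?_
  obtain ⟨k, hk⟩ := hng x
  obtain ⟨w, a, b, h⟩ := hρ.exists_isHyperbolic_of_parabolic
    (hρ.isPositiveCone_posTop.ne_one ht) hle hx.symm hk
  exact hnh _ _ _ h

/-- Domination at both ends would be domination at every point by `lt_of_pos`, whereas powers of
`c`, or of `c⁻¹`, push a point near `+∞` beyond any bound. -/
theorem AtMostTwoFixed.not_dominated (hρ : AtMostTwoFixed ρ) (hng : ∀ p, ∃ k, ρ k p ≠ p)
    {G c : Γ} (hc : c ≠ 1) (ht : ∀ i : ℤ, PosTop ρ ((c ^ i)⁻¹ * G))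
    (hb : ∀ i : ℤ, PosBot ρ ((c ^ i)⁻¹ * G)) : False := by
  wlog hpos : PosTop ρ c generalizing c
  · exact this (inv_ne_one.mpr hc) (fun i => by simpa using ht (-i))
      (fun i => by simpa using hb (-i))
      ((hρ.posTop_or hc).resolve_left hpos)
  obtain ⟨M, hM⟩ := eventually_atTop.mp hpos
  obtain ⟨n, hn⟩ := exists_pow_gt ρ (g := c) (le_max_left M (ρ G M)) (fun z hz _ => hM z hz)
  have h1 := hρ.lt_of_pos hng (ht n) (hb n) M
  rw [apply_mul, lt_inv_iff, zpow_natCast] at h1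
  exact absurd h1 (not_lt.mpr ((le_max_right _ _).trans (hn n le_rfl).le))

/-- Here `e = f * g⁻¹` has opposite signs at the two ends. Powers of `e` bound `g` at both ends, so
the commutator of `e` and `g` is infinitesimal relative to `e` at `+∞` and to `e⁻¹` at `-∞`. But `f
* g` exceeds `e` at `+∞` and `e⁻¹` at `-∞`, so it dominates every power of that commutator. -/
theorem AtMostTwoFixed.not_posTop_and_posBot_inv (hρ : AtMostTwoFixed ρ)
    (hng : ∀ p, ∃ k, ρ k p ≠ p) {f g : Γ} (hfb : PosBot ρ f)
    (hgt : PosTop ρ g) (hgb : PosBot ρ g) (het : PosTop ρ (f * g⁻¹))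
    (heb : PosBot ρ (f * g⁻¹)⁻¹) : False := by
  have hP := hρ.isPositiveCone_posTop
  have hQ := hρ.isPositiveCone_posBot
  set e := f * g⁻¹ with he
  have heg : e⁻¹ = g * f⁻¹ := by simp [he]
  obtain ⟨N, hN⟩ : ∃ N : ℕ, ¬ PosBot ρ (e ^ N * g) := by
    by_contra! hcon
    have hlt : ∀ (n : ℕ) (x : X), x < ρ (e ^ n * g) x := fun n =>
      hρ.lt_of_pos hng (by
        rcases eq_or_ne n 0 with rfl | hn
        · simpa using hgt
        · exact hP.mul (hP.pow het hn) hgt) (hcon n)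
    obtain ⟨M, hM⟩ := eventually_atBot.mp ((posBot_inv ρ).mp heb)
    obtain ⟨n, hn⟩ := exists_pow_lt ρ (g := e) (min_le_left M (ρ g⁻¹ M)) (fun z _ hz => hM z hz)
    have h1 := hlt n (ρ g⁻¹ M)
    rw [apply_mul, apply_apply_inv] at h1
    exact absurd h1 (not_lt.mpr ((hn n le_rfl).le.trans (min_le_right _ _)))
  obtain ⟨K, hK⟩ : ∃ K : ℕ, ¬ PosTop ρ ((e ^ K)⁻¹ * f) := by
    by_contra! hcon
    have hlt : ∀ (n : ℕ) (x : X), x < ρ ((e ^ n)⁻¹ * f) x := fun n =>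
      hρ.lt_of_pos hng (hcon n) (by
        rcases eq_or_ne n 0 with rfl | hn
        · simpa using hfb
        · rw [← inv_pow]; exact hQ.mul (hQ.pow heb hn) hfb)
    obtain ⟨M, hM⟩ := eventually_atTop.mp het
    obtain ⟨n, hn⟩ := exists_pow_gt ρ (g := e) (le_max_left M (ρ f M)) (fun z hz _ => hM z hz)
    have h1 := hlt n M
    rw [apply_mul, lt_inv_iff] at h1
    exact absurd h1 (not_lt.mpr ((le_max_right _ _).trans (hn n le_rfl).le))
  have hpow : ∀ {P : Γ → Prop} (_ : IsPositiveCone P) {a : Γ} (_ : P a) (n : ℕ) {b : Γ},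
      P b → P (a ^ n * b) := fun hP a ha n b hb => by
    rcases eq_or_ne n 0 with rfl | hn
    · simpa using hb
    · exact hP.mul (hP.pow ha hn) hb
  refine hρ.not_dominated hng (G := f * g) (c := e * g * e⁻¹ * g⁻¹) (fun hc => ?_)
    (fun j => ?_) (fun j => ?_)
  -- If `e` and `g` commuted, `g` would fix the fixed points of `e`, but it is positive everywhere.
  · obtain ⟨p, hp⟩ := exists_fixed_of_posTop het heb
    have hcomm : e * g = g * e := by
      rw [mul_inv_eq_one, mul_inv_eq_iff_eq_mul] at hc
      exact hc
    exact absurd (hρ.fixed_of_commute (hP.ne_one het) hcomm hp) (hρ.lt_of_pos hng hgt hgb p).ne'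
  · refine hP.lt_trans (hP.commutator_lt het (N := K) ?_ (fun h => hK ?_) j) ?_
    · have := hP.not_inv (hpow hP het K hgt)
      rwa [mul_inv_rev] at this
    · refine hP.lt_trans h ?_
      rw [hP.mul_comm_iff]
      exact het
    · have : e⁻¹ * (f * g) = g * g := by rw [heg]; group
      rw [this]
      exact hP.mul hgt hgt
  · have hc := hQ.commutator_lt (f := e⁻¹) (g := g) heb (N := N) ?_ ?_ (-j)
    · refine hQ.lt_trans (b := e⁻¹) ?_ ?_
      · have hd : ∀ {c d : Γ}, c = e * d⁻¹ * e⁻¹ →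
            (c ^ j)⁻¹ * e⁻¹ = e * ((d ^ (-j))⁻¹ * e⁻¹) * e⁻¹ := by
          rintro c d rfl
          rw [conj_zpow, zpow_neg, inv_inv, inv_zpow]
          group
        rw [hd (d := e⁻¹ * g * e⁻¹⁻¹ * g⁻¹) (by group)]
        exact hQ.conj e hc
      · have : e⁻¹⁻¹ * (f * g) = f * (g⁻¹ * f * (g⁻¹)⁻¹) := by rw [inv_inv, he]; group
        rw [this]
        exact hQ.mul hfb (hQ.conj _ hfb)
    · have := hQ.not_inv (hpow hQ heb N hgb)
      rwa [mul_inv_rev] at this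
    · simpa using hN

theorem AtMostTwoFixed.isTranslation_of_pos (hρ : AtMostTwoFixed ρ)
    (hng : ∀ p, ∃ k, ρ k p ≠ p) {g : Γ} (ht : PosTop ρ g) (hb : PosBot ρ g) :
    IsTranslation ρ g :=
  Or.inr fun x => (hρ.lt_of_pos hng ht hb x).ne'

theorem AtMostTwoFixed.isTranslation_mul_inv (hρ : AtMostTwoFixed ρ)
    (hng : ∀ p, ∃ k, ρ k p ≠ p) {f g : Γ} (hft : PosTop ρ f) (hfb : PosBot ρ f)
    (hgt : PosTop ρ g) (hgb : PosBot ρ g) : IsTranslation ρ (f * g⁻¹) := by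
  have hfg : g * f⁻¹ = (f * g⁻¹)⁻¹ := by simp
  rcases hρ.isPositiveCone_posTop.tri (f * g⁻¹) with h | h | h
  · exact Or.inl h
  · rcases hρ.isPositiveCone_posBot.tri (f * g⁻¹) with h' | h' | h'
    · exact Or.inl h'
    · exact hρ.isTranslation_of_pos hng h h'
    · exact (hρ.not_posTop_and_posBot_inv hng hfb hgt hgb h h').elim
  · rcases hρ.isPositiveCone_posBot.tri (f * g⁻¹) with h' | h' | h'
    · exact Or.inl h'
    · exact (hρ.not_posTop_and_posBot_inv hng hgb hft hfb (hfg ▸ h)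
        (by rw [hfg, inv_inv]; exact h')).elim
    · rw [← inv_inv (f * g⁻¹)]
      exact isTranslation_inv (hρ.isTranslation_of_pos hng h h')

/-- Without global fixed points, the elements without fixed points form a subgroup together with
the identity. -/
theorem AtMostTwoFixed.isTranslation_mul (hρ : AtMostTwoFixed ρ)
    (hng : ∀ p, ∃ k, ρ k p ≠ p) {f g : Γ} (hf : IsTranslation ρ f) (hg : IsTranslation ρ g) :
    IsTranslation ρ (f * g) := by
  have hP := hρ.isPositiveCone_posTop
  have hQ := hρ.isPositiveCone_posBot
  rcases hf with rfl | hf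
  · rwa [one_mul]
  rcases hg with rfl | hg
  · rw [mul_one]; exact Or.inr hf
  rcases pos_or_neg_of_free hf with ⟨h1, h2⟩ | ⟨h1, h2⟩ <;>
  rcases pos_or_neg_of_free hg with ⟨h3, h4⟩ | ⟨h3, h4⟩
  · exact hρ.isTranslation_of_pos hng (hP.mul h1 h3) (hQ.mul h2 h4)
  · simpa using hρ.isTranslation_mul_inv hng h1 h2 h3 h4
  · have := isTranslation_conj (hρ.isTranslation_mul_inv hng h3 h4 h1 h2) f
    simpa [mul_assoc] using this
  · have := isTranslation_inv (hρ.isTranslation_of_pos hng (hP.mul h3 h1) (hQ.mul h4 h2))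
    simpa using this

end OrderAction

/-! ### Commutativity of free actions and of actions with a global fixed point; common fixed points
-/

namespace OrderAction

variable {Γ X : Type*} [Group Γ] [LinearOrder X] {ρ : Γ →* (X ≃o X)}

theorem fixed_of_inv {g : Γ} {x : X} (h : ρ g⁻¹ x = x) : ρ g x = x := by
  simpa using inv_fixed ρ h

/-- The restriction of an action to the points above a global fixed point. -/
def restrictIoi (ρ : Γ →* (X ≃o X)) (p : X) (hp : ∀ g, ρ g p = p) :
    Γ →* (Set.Ioi p ≃o Set.Ioi p) where
  toFun g :=
    { toFun := fun x => ⟨ρ g x, by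
        have := (ρ g).strictMono x.2
        rwa [hp] at this⟩
      invFun := fun x => ⟨ρ g⁻¹ x, by
        have := (ρ g⁻¹).strictMono x.2
        rwa [hp] at this⟩
      left_inv := fun x => Subtype.ext (apply_inv_apply ρ g x)
      right_inv := fun x => Subtype.ext (apply_apply_inv ρ g x)
      map_rel_iff' := fun {_ _} => (ρ g).le_iff_le }
  map_one' := by ext x; exact apply_one ρ (x : X)
  map_mul' g h := by ext x; exact apply_mul ρ g h (x : X)

theorem AtMostTwoFixed.restrictIoi (hρ : AtMostTwoFixed ρ) {p : X} (hp : ∀ g, ρ g p = p) :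
    AtMostTwoFixed (restrictIoi ρ p hp) := fun g hg => by
  rw [← Subtype.val_injective.encard_image]
  refine (Set.encard_le_encard ?_).trans (hρ g hg)
  rintro _ ⟨x, hx, rfl⟩
  exact congrArg Subtype.val hx

section

variable [IsDedekindComplete X] [NoMinOrder X] [NoMaxOrder X] [Nonempty X]

theorem AtMostTwoFixed.exists_max_fixed (hρ : AtMostTwoFixed ρ) {e : Γ}
    (ht : PosTop ρ e) (hb : PosBot ρ e⁻¹) : ∃ M, ρ e M = M ∧ ∀ x > M, x < ρ e x := by
  obtain ⟨M, hM, hmax⟩ := Set.exists_max_image _ id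
    (hρ.finite (hρ.isPositiveCone_posTop.ne_one ht)) (exists_fixed_of_posTop ht hb)
  refine ⟨M, hM, fun x hx => ?_⟩
  obtain ⟨y, hy, hy'⟩ := (ht.and (eventually_gt_atTop M)).exists
  exact lt_apply_of_forall_ne ρ (s := Set.Ioi M) Set.ordConnected_Ioi
    (fun z hz h => absurd (hmax z h) (not_le.mpr hz)) hy' hx hy

theorem AtMostTwoFixed.exists_min_fixed (hρ : AtMostTwoFixed ρ) {e : Γ}
    (ht : PosTop ρ e) (hb : PosBot ρ e⁻¹) : ∃ m, ρ e m = m ∧ ∀ x < m, ρ e x < x :=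
  hρ.dual.exists_max_fixed (e := e) ((posBot_inv ρ).mp hb) ((posBot_dual_inv ρ).mpr ht)

theorem AtMostTwoFixed.not_infinitesimal (hρ : AtMostTwoFixed ρ)
    (hopp : ∀ g : Γ, PosTop ρ g → PosBot ρ g⁻¹) {e c : Γ} (he : PosTop ρ e) (hc : PosTop ρ c)
    (hdisj : ∀ x, ρ e x = x → ρ c x ≠ x) (hlt : ∀ i : ℕ, PosTop ρ ((c ^ i)⁻¹ * e)) : False := by
  -- With the signs at the two ends, such `u` and `v` make `(c ^ n)⁻¹ * e` alternate. They are found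
  -- by comparing the extreme fixed points `m, M` of `e` with the extreme fixed points `s, r` of
  -- `c`.
  suffices H : ∃ (n : ℕ) (u v : X), u < v ∧ ρ (c ^ n) u < ρ e u ∧ ρ e v < ρ (c ^ n) v by
    obtain ⟨n, u, v, huv, hu, hv⟩ := H
    have ht := hlt n
    obtain ⟨r, hr, hr'⟩ := (ht.and (eventually_gt_atTop v)).exists
    obtain ⟨l, hl, hl'⟩ :=
      (((posBot_inv ρ).mp (hopp _ ht)).and (eventually_lt_atBot u)).exists
    exact hρ.not_alternating (g := (c ^ n)⁻¹ * e) hl' huv hr' hl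
      (by rwa [apply_mul, lt_inv_iff]) (by rwa [apply_mul, inv_lt_iff]) hr
  obtain ⟨M, hM, hM'⟩ := hρ.exists_max_fixed he (hopp e he)
  obtain ⟨m, hm, hm'⟩ := hρ.exists_min_fixed he (hopp e he)
  obtain ⟨r, hr, hr'⟩ := hρ.exists_max_fixed hc (hopp c hc)
  obtain ⟨s, hs, hs'⟩ := hρ.exists_min_fixed hc (hopp c hc)
  rcases lt_trichotomy r M with hrM | rfl | hrM
  · rcases lt_trichotomy s m with hsm | rfl | hsm
    · obtain ⟨u, hu⟩ := exists_lt s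
      obtain ⟨n, hn⟩ := exists_pow_lt ρ (g := c) (hm' u (hu.trans hsm)).le
        (fun z _ hz => hs' z (hz.trans_lt hu))
      exact ⟨n, u, s, hu, hn n le_rfl, by rw [pow_fixed ρ hs]; exact hm' s hsm⟩
    · exact (hdisj _ hm hs).elim
    · have hsr : s ≤ r := not_lt.mp fun h => (hs' r h).ne hr
      exact ⟨1, m, M, hsm.trans_le (hsr.trans hrM.le), by rw [pow_one, hm]; exact hs' m hsm,
        by rw [pow_one, hM]; exact hr' M hrM⟩
  · exact (hdisj _ hM hr).elim
  · obtain ⟨v, hv⟩ := exists_gt r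
    obtain ⟨n, hn⟩ := exists_pow_gt ρ (g := c) (hM' v (hrM.trans hv)).le
      (fun z hz _ => hr' z (hv.trans_le hz))
    exact ⟨n, r, v, hv, by rw [pow_fixed ρ hr]; exact hM' r hrM, hn n le_rfl⟩

end

variable [IsDedekindComplete X] [NoMaxOrder X] [DenselyOrdered X]

/-- A group acting freely on a line is commutative. -/
theorem commute_of_free [NoMinOrder X] [Nonempty X] (hfree : ∀ g : Γ, g ≠ 1 → ∀ x, ρ g x ≠ x)
    (f g : Γ) : f * g = g * f := by
  have hρ : AtMostTwoFixed ρ := fun g hg => by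
    rw [show Function.fixedPoints (ρ g) = ∅ from Set.eq_empty_of_forall_notMem (hfree g hg)]
    simp
  have hP := hρ.isPositiveCone_posTop
  have hall : ∀ {k : Γ}, PosTop ρ k → ∀ x, x < ρ k x := fun {k} hk => by
    refine (lt_or_gt_of_free (hfree k (hP.ne_one hk))).resolve_right fun h => ?_
    obtain ⟨x, hx⟩ := hk.exists
    exact absurd (h x) hx.not_gt
  rcases eq_or_ne f 1 with rfl | hf
  · simp
  wlog hpos : PosTop ρ f generalizing f
  · have := this f⁻¹ (inv_ne_one.mpr hf) ((hP.tri f).resolve_left hf |>.resolve_left hpos)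
    rw [inv_mul_eq_iff_eq_mul, ← mul_assoc] at this
    rw [eq_mul_inv_iff_mul_eq] at this
    exact this.symm
  have hng : ∀ p, ∃ k, ρ k p ≠ p := fun p => ⟨f, hfree f hf p⟩
  obtain ⟨x⟩ := ‹Nonempty X›
  -- In a free action, comparison at the single point `x` decides the order, so this one `N` bounds
  -- `g` on both sides.
  obtain ⟨N, hN⟩ := exists_pow_gt ρ (g := f) (min_le_max (a := x) (b := ρ g x))
    (fun z _ _ => hall hpos z)
  have hN' := hN N le_rfl
  by_contra hne
  have hlt := hP.commutator_lt hpos (g := g) (N := N) (fun h => ?_) (fun h => ?_)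
  · refine hρ.not_dominated hng (c := f * g * f⁻¹ * g⁻¹) (fun hc => hne ?_) hlt
      (fun i => .of_forall (hall (hlt i)))
    rwa [mul_inv_eq_one, mul_inv_eq_iff_eq_mul] at hc
  · have := hall h x
    rw [apply_mul, lt_inv_iff, lt_inv_iff] at this
    exact absurd this (not_lt.mpr ((le_max_left _ _).trans (hN'.le.trans
      ((ρ (f ^ N)).monotone (min_le_right _ _)))))
  · have := hall h x
    rw [apply_mul, lt_inv_iff] at this
    exact absurd this (not_lt.mpr ((le_max_right _ _).trans (hN'.le.trans
      ((ρ (f ^ N)).monotone (min_le_left _ _)))))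

theorem commute_of_free_Ioi {p : X} (hp : ∀ g, ρ g p = p)
    (hfree : ∀ g : Γ, g ≠ 1 → ∀ x > p, ρ g x ≠ x) (f g : Γ) : f * g = g * f :=
  commute_of_free (ρ := restrictIoi ρ p hp)
    (fun k hk x hx => hfree k hk x x.2 (congrArg Subtype.val hx)) f g

/-- A second global fixed point `y > p` makes the action free above `y`, as a further fixed point
would be a third. -/
theorem AtMostTwoFixed.commute_or (hρ : AtMostTwoFixed ρ) {p : X} (hp : ∀ g, ρ g p = p) :
    (∀ f g : Γ, f * g = g * f) ∨
      ((∃ e : Γ, e ≠ 1 ∧ ∃ x > p, ρ e x = x) ∧ ∀ y > p, ∃ k, ρ k y ≠ y) := by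
  by_cases hfree : ∀ g : Γ, g ≠ 1 → ∀ x > p, ρ g x ≠ x
  · exact Or.inl (commute_of_free_Ioi hp hfree)
  by_cases hng : ∀ y > p, ∃ k, ρ k y ≠ y
  · push Not at hfree
    obtain ⟨e, he, x, hx, hx'⟩ := hfree
    exact Or.inr ⟨⟨e, he, x, hx, hx'⟩, hng⟩
  · push Not at hng
    obtain ⟨y, hy, hy'⟩ := hng
    exact Or.inl (commute_of_free_Ioi hy' fun g hg z hz h =>
      hg (hρ.eq_one hy hz (hp g) (hy' g) h))

/-- If `e` has a fixed point above a global fixed point `p` while `d` has none, then `d * e` has a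
fixed point above `p`. -/
theorem AtMostTwoFixed.exists_fixed_mul (hρ : AtMostTwoFixed ρ) {p : X} (hp : ∀ g, ρ g p = p)
    (hng : ∀ y > p, ∃ k, ρ k y ≠ y) {e d : Γ} (he : e ≠ 1) {x : X} (hx : p < x) (hex : ρ e x = x)
    (hd : ∀ y > p, ρ d y ≠ y) : d * e ≠ 1 ∧ ∃ z > p, ρ (d * e) z = z := by
  have hng' : ∀ y : Set.Ioi p, ∃ k, OrderAction.restrictIoi ρ p hp k y ≠ y := fun y => by
    obtain ⟨k, hk⟩ := hng y y.2
    exact ⟨k, fun h => hk (congrArg Subtype.val h)⟩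
  have hdT : IsTranslation (OrderAction.restrictIoi ρ p hp) d :=
    Or.inr fun y h => hd y y.2 (congrArg Subtype.val h)
  have hde : ¬ IsTranslation (OrderAction.restrictIoi ρ p hp) (d * e) := fun h => by
    have := (hρ.restrictIoi hp).isTranslation_mul hng' (isTranslation_inv hdT) h
    rw [inv_mul_cancel_left] at this
    rcases this with h | h
    · exact he h
    · exact h ⟨x, hx⟩ (Subtype.ext hex)
  refine ⟨fun h => hde (Or.inl h), ?_⟩
  by_contra! hcon
  exact hde (Or.inr fun y h => hcon y y.2 (congrArg Subtype.val h))

variable [NoMinOrder X]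

/-- A group with at most two fixed points and a global fixed point is commutative. -/
theorem AtMostTwoFixed.commute_of_global (hρ : AtMostTwoFixed ρ) {p : X} (hp : ∀ g, ρ g p = p)
    (f g : Γ) : f * g = g * f := by
  rcases hρ.commute_or hp with h | ⟨⟨e, he, x, hx, hex⟩, hng⟩
  · exact h f g
  rcases hρ.dual.commute_or (p := OrderDual.toDual p) hp with h | ⟨⟨d, hd, y, hy, hdy⟩, hng'⟩
  · exact h f g
  have hy' : OrderDual.ofDual y < p := hy
  -- `e` fixes a point above `p`, hence none below; `d` behaves the opposite way. So `d * e` fixes a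
  -- point on each side of `p` and `p` itself, which is too many.
  obtain ⟨h1, z, hz, hz'⟩ := hρ.exists_fixed_mul hp hng he hx hex (d := d)
    (fun u hu h => hd (hρ.eq_one hy' hu hdy (hp d) h))
  obtain ⟨-, v, hv, hv'⟩ := hρ.dual.exists_fixed_mul (p := OrderDual.toDual p) hp hng'
    (inv_ne_one.mpr hd) hy (inv_fixed (OrderAction.dual ρ) hdy) (d := e⁻¹)
    (fun u hu h => he (hρ.eq_one (show OrderDual.ofDual u < p from hu) hx
      (fixed_of_inv (ρ := OrderAction.dual ρ) h) (hp e) hex))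
  rw [← mul_inv_rev] at hv'
  exact absurd (hρ.eq_one (show OrderDual.ofDual v < p from hv) hz
    (fixed_of_inv (ρ := OrderAction.dual ρ) hv') (hp _) hz') h1

/-- Non-trivial elements with a common fixed point have the same fixed points. -/
theorem AtMostTwoFixed.fixed_of_common (hρ : AtMostTwoFixed ρ) {e g : Γ} (he : e ≠ 1) {q : X}
    (heq : ρ e q = q) (hgq : ρ g q = q) {x : X} (hx : ρ e x = x) : ρ g x = x := by
  let S : Subgroup Γ :=
    { carrier := {k | ρ k q = q}
      mul_mem' := fun {a b} ha hb => by
        show ρ (a * b) q = q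
        rw [apply_mul, show ρ b q = q from hb]; exact ha
      one_mem' := apply_one ρ q
      inv_mem' := fun {a} ha => inv_fixed ρ ha }
  have hS : AtMostTwoFixed (ρ.comp S.subtype) := fun k hk => hρ k (by simpa using hk)
  have hcomm := hS.commute_of_global (p := q) (fun k => k.2) ⟨e, heq⟩ ⟨g, hgq⟩
  exact hρ.fixed_of_commute he (congrArg Subtype.val hcomm) hx

/-- If every element has different signs at the two ends, then non-trivial elements have common
fixed points. -/
theorem AtMostTwoFixed.exists_common_fixed [Nonempty X] (hρ : AtMostTwoFixed ρ)
    (hopp : ∀ g : Γ, PosTop ρ g → PosBot ρ g⁻¹) {e g : Γ} (he : e ≠ 1) (hg : g ≠ 1) :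
    ∃ x, ρ e x = x ∧ ρ g x = x := by
  have hP := hρ.isPositiveCone_posTop
  wlog het : PosTop ρ e generalizing e
  · obtain ⟨x, hx, hx'⟩ := this (inv_ne_one.mpr he) ((hρ.posTop_or he).resolve_left het)
    exact ⟨x, fixed_of_inv hx, hx'⟩
  wlog hgt : PosTop ρ g generalizing g
  · obtain ⟨x, hx, hx'⟩ := this (inv_ne_one.mpr hg) ((hρ.posTop_or hg).resolve_left hgt)
    exact ⟨x, hx, fixed_of_inv hx'⟩
  wlog hle : ¬ PosTop ρ (e⁻¹ * g) generalizing e g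
  · rw [not_not] at hle
    obtain ⟨x, hx, hx'⟩ := this hg hgt he het (by simpa using hP.not_inv hle)
    exact ⟨x, hx', hx⟩
  by_contra! hdisj
  have hlt := hP.commutator_lt het (g := g) (N := 1)
    (by rw [pow_one, ← mul_inv_rev]; exact hP.not_inv (hP.mul het hgt)) (by rwa [pow_one])
  set c := e * g * e⁻¹ * g⁻¹ with hc
  obtain ⟨p, hp⟩ := exists_fixed_of_posTop het (hopp e het)
  have hc1 : c ≠ 1 := fun h => by
    rw [hc, mul_inv_eq_one, mul_inv_eq_iff_eq_mul] at h
    exact hdisj p hp (hρ.fixed_of_commute he h hp)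
  -- If `c` shares a fixed point with `e`, it fixes all those of `e`; then `g⁻¹` preserves this
  -- finite set, hence fixes it pointwise, against `hdisj`.
  have hec : ∀ x, ρ e x = x → ρ c x ≠ x := fun q hq hcq => by
    refine hdisj q hq (fixed_of_inv (fixed_of_mapsTo_finite (hρ.finite he) (k := g⁻¹)
      (fun x hx => ?_) hq))
    have h1 : ρ e x = x := hx
    have h2 : ρ c x = x := hρ.fixed_of_common he hq hcq h1
    have h3 : ρ e⁻¹ (ρ g⁻¹ x) = ρ g⁻¹ x := by
      rw [hc, apply_mul, apply_mul, apply_mul] at h2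
      conv_rhs at h2 => rw [← h1]
      rw [(ρ e).injective.eq_iff, eq_comm, ← inv_eq_iff] at h2
      exact h2.symm
    exact fixed_of_inv h3
  rcases hρ.posTop_or hc1 with hct | hct
  · exact hρ.not_infinitesimal hopp het hct hec (fun i => by simpa using hlt i)
  · exact hρ.not_infinitesimal hopp het hct (fun x hx h => hec x hx (fixed_of_inv h))
      (fun i => by simpa using hlt (-i))

end OrderAction

/-! ### Translation numbers and the semi-conjugacy to an affine group -/

namespace OrderAction

variable {Γ : Type*} [Group Γ]

section Embedding

variable {X : Type*} [LinearOrder X] {ρ : Γ →* (X ≃o X)} [IsDedekindComplete X]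

theorem lt_apply_of_lt_of_free [Nonempty X] (hfree : ∀ g : Γ, g ≠ 1 → ∀ x, ρ g x ≠ x) {a b : Γ}
    {x : X} (h : ρ a x < ρ b x) (y : X) : ρ a y < ρ b y := by
  rw [← lt_inv_iff, ← apply_mul] at h ⊢
  refine (lt_or_gt_of_free (hfree _ (ne_one_of_lt h))).resolve_right (fun h' => ?_) y
  exact absurd (h' x) h.not_gt

variable [NoMaxOrder X] [NoMinOrder X] [DenselyOrdered X]

/-- Hölder's theorem: a free action on a line has a faithful translation number. -/
theorem exists_translation_number (hfree : ∀ g : Γ, g ≠ 1 → ∀ x, ρ g x ≠ x) (x₀ : X) :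
    ∃ τ : Γ → ℝ, (∀ a b, τ (a * b) = τ a + τ b) ∧ ∀ a b, ρ a x₀ < ρ b x₀ → τ a < τ b := by
  have : Nonempty X := ⟨x₀⟩
  have hinj : Function.Injective fun g : Γ => ρ g x₀ := fun a b h => by
    by_contra hne
    refine hfree (a⁻¹ * b) (fun h' => hne (inv_mul_eq_one.mp h')) x₀ ?_
    rw [apply_mul, inv_eq_iff]
    exact h.symm
  let _ : CommGroup Γ := { ‹Group Γ› with mul_comm := commute_of_free hfree }
  let _ : LinearOrder Γ := LinearOrder.lift' (fun g : Γ => ρ g x₀) hinj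
  have hlt : ∀ {a b : Γ}, a < b ↔ ρ a x₀ < ρ b x₀ := Iff.rfl
  have hmul : ∀ a b : Γ, a ≤ b → ∀ c, a * c ≤ b * c := fun a b h c => by
    show ρ (a * c) x₀ ≤ ρ (b * c) x₀
    rw [mul_comm a, mul_comm b, apply_mul, apply_mul]
    exact (ρ c).monotone h
  have : IsOrderedMonoid Γ := { mul_le_mul_left := hmul }
  have : MulArchimedean Γ := ⟨fun a b hb => by
    have hb' : ∀ x, x < ρ b x := fun x => by
      simpa using lt_apply_of_lt_of_free hfree (a := 1) (b := b) hb x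
    rcases le_total (ρ a x₀) x₀ with h | h
    · exact ⟨0, by show ρ a x₀ ≤ ρ (b ^ 0) x₀; simpa using h⟩
    · obtain ⟨n, hn⟩ := exists_pow_gt ρ (g := b) h (fun z _ _ => hb' z)
      exact ⟨n, (hn n le_rfl).le⟩⟩
  obtain ⟨f, hf⟩ := Archimedean.exists_orderAddMonoidHom_real_injective (Additive Γ)
  exact ⟨fun g => f (Additive.ofMul g), fun a b => map_add f (Additive.ofMul a) (Additive.ofMul b),
    fun a b h => (f.monotone'.strictMono_of_injective hf)
      (show Additive.ofMul a < Additive.ofMul b from h)⟩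

end Embedding

/-- Two additive functions with the same sign are proportional. -/
theorem exists_pos_mul_eq {τ φ : Γ → ℝ} (hτ : ∀ a b, τ (a * b) = τ a + τ b)
    (hφ : ∀ a b, φ (a * b) = φ a + φ b) (hpos : ∀ n, 0 < τ n → 0 < φ n) {t : Γ} (ht : 0 < τ t) :
    ∃ c : ℝ, 0 < c ∧ ∀ n, φ n = c * τ n := by
  have hz : ∀ {ψ : Γ → ℝ}, (∀ a b, ψ (a * b) = ψ a + ψ b) → ∀ a (k : ℤ), ψ (a ^ k) = k * ψ a :=
    fun {ψ} hψ a k => by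
      have := map_zsmul (AddMonoidHom.mk' (fun x : Additive Γ => ψ x.toMul) (fun x y => hψ _ _)) k
        (Additive.ofMul a)
      simpa using this
  have hinv : ∀ {ψ : Γ → ℝ}, (∀ a b, ψ (a * b) = ψ a + ψ b) → ∀ a, ψ a⁻¹ = - ψ a :=
    fun {ψ} hψ a => by simpa using hz hψ a (-1)
  have hφt := hpos t ht
  have key : ∀ n, τ n / τ t ≤ φ n / φ t := fun n => by
    by_contra! hlt
    obtain ⟨q, hq1, hq2⟩ := exists_rat_btwn hlt
    have hd : (0 : ℝ) < q.den := by exact_mod_cast q.den_pos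
    have hqe : (q : ℝ) = q.num / q.den := Rat.cast_def q
    rw [hqe, div_lt_div_iff₀ hφt hd] at hq1
    rw [hqe, div_lt_div_iff₀ hd ht] at hq2
    -- A rational strictly between the two ratios gives an element on which `τ` is positive and `φ`
    -- negative.
    have h1 := hpos (n ^ (q.den : ℤ) * (t ^ q.num)⁻¹) (by
      rw [hτ, hinv hτ, hz hτ, hz hτ]; push_cast; linarith)
    rw [hφ, hinv hφ, hz hφ, hz hφ] at h1
    push_cast at h1
    linarith
  refine ⟨φ t / τ t, div_pos hφt ht, fun n => ?_⟩
  have h1 := key n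
  have h2 := key n⁻¹
  rw [hinv hτ, hinv hφ, neg_div, neg_div, neg_le_neg_iff] at h2
  have h3 := le_antisymm h1 h2
  field_simp at h3 ⊢
  linarith

/-- The map to the line semi-conjugating a free action to an action by translations. -/
theorem exists_semiconj_translation {ρ : Γ →* (ℝ ≃o ℝ)} {τ : Γ → ℝ}
    (hτ : ∀ a b, τ (a * b) = τ a + τ b) (hlt : ∀ a b, ρ a 0 < ρ b 0 → τ a < τ b) {t : Γ}
    (ht : ∀ x, x < ρ t x) :
    ∃ h : ℝ → ℝ, Monotone h ∧ ∀ n x, h (ρ n x) = h x + τ n := by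
  have hup : ∀ x, ∃ n : Γ, x < ρ n 0 := fun x => by
    obtain ⟨n, hn⟩ := exists_pow_gt ρ (g := t) (le_max_left 0 x) (fun z _ _ => ht z)
    exact ⟨t ^ n, (le_max_right _ _).trans_lt (hn n le_rfl)⟩
  have hdown : ∀ x, ∃ n : Γ, ρ n 0 ≤ x := fun x => by
    obtain ⟨n, hn⟩ := exists_pow_lt ρ (g := t⁻¹) (min_le_left 0 x)
      (fun z _ _ => (inv_lt_iff ρ).mpr (ht z))
    exact ⟨t⁻¹ ^ n, (hn n le_rfl).le.trans (min_le_right _ _)⟩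
  have hlub : ∀ x, IsLUB (τ '' {n | ρ n 0 ≤ x}) (sSup (τ '' {n | ρ n 0 ≤ x})) := fun x => by
    obtain ⟨a, ha⟩ := hup x
    obtain ⟨b, hb⟩ := hdown x
    refine isLUB_csSup ⟨_, b, hb, rfl⟩ ⟨τ a, ?_⟩
    rintro _ ⟨n, hn, rfl⟩
    exact (hlt _ _ (lt_of_le_of_lt hn ha)).le
  refine ⟨fun x => sSup (τ '' {n | ρ n 0 ≤ x}), fun x y hxy => ?_, fun n x => ?_⟩
  · exact (hlub x).mono (hlub y) (Set.image_mono fun n (hn : ρ n 0 ≤ x) => hn.trans hxy)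
  · refine (hlub (ρ n x)).unique ⟨?_, fun u hu => ?_⟩
    · rintro _ ⟨m, hm, rfl⟩
      have : τ (n⁻¹ * m) ≤ _ := (hlub x).1 ⟨n⁻¹ * m, by
        show ρ (n⁻¹ * m) 0 ≤ x
        rw [apply_mul, ← not_lt, lt_inv_iff, not_lt]; exact hm, rfl⟩
      have h2 := hτ n (n⁻¹ * m)
      rw [mul_inv_cancel_left] at h2
      linarith
    · rw [← le_sub_iff_add_le]
      refine (hlub x).2 ?_
      rintro _ ⟨m, hm, rfl⟩
      rw [le_sub_iff_add_le, add_comm, ← hτ]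
      exact hu ⟨n * m, by
        show ρ (n * m) 0 ≤ ρ n x
        rw [apply_mul]; exact (ρ n).monotone hm, rfl⟩

/-- The increments of `h` and `k` between two points are squeezed between the same translation
numbers, which are dense. -/
theorem sub_eq_sub_of_equivariant {ρ : Γ →* (ℝ ≃o ℝ)} {τ : Γ → ℝ} (hd : DenseRange τ)
    {h k : ℝ → ℝ} (hm : Monotone h) (hh : ∀ n x, h (ρ n x) = h x + τ n) (km : Monotone k)
    (hk : ∀ n x, k (ρ n x) = k x + τ n) (x y : ℝ) : k y - h y = k x - h x := by
  refine eq_of_forall_dist_le fun ε hε => ?_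
  obtain ⟨_, ⟨a, rfl⟩, ha⟩ :=
    hd.exists_between (show h y - h x - ε / 2 < h y - h x by linarith)
  obtain ⟨_, ⟨b, rfl⟩, hb⟩ :=
    hd.exists_between (show h y - h x < h y - h x + ε / 2 by linarith)
  have hay : ρ a x ≤ y := le_of_not_gt fun hlt => by
    have := hm hlt.le
    rw [hh] at this
    linarith [ha.2]
  have hby : y ≤ ρ b x := le_of_not_gt fun hlt => by
    have := hm hlt.le
    rw [hh] at this
    linarith [hb.1]
  have h1 := km hay
  have h2 := km hby
  rw [hk] at h1 h2
  rw [Real.dist_eq, abs_le]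
  constructor <;> linarith [ha.1, ha.2, hb.1, hb.2]

/-- The action of a subgroup consisting of increasing homeomorphisms. -/
def ofSubgroup (K : Subgroup (ℝ ≃ₜ ℝ)) (hK : ∀ g ∈ K, StrictMono g) : K →* (ℝ ≃o ℝ) where
  toFun g :=
    { toEquiv := (g : ℝ ≃ₜ ℝ).toEquiv
      map_rel_iff' := fun {_ _} => (hK g g.2).le_iff_le }
  map_one' := rfl
  map_mul' _ _ := rfl

/-- A real-valued homomorphism without least positive value has dense range. -/
theorem denseRange_of_no_min {τ : Γ → ℝ} (hτ : ∀ a b, τ (a * b) = τ a + τ b) {t : Γ}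
    (ht : 0 < τ t) (hmin : ∀ t, 0 < τ t → ∃ s, 0 < τ s ∧ τ s < τ t) : DenseRange τ := by
  set S : AddSubgroup ℝ :=
    (AddMonoidHom.mk' (fun x : Additive Γ => τ x.toMul) (fun x y => hτ _ _)).range with hS
  have hmem : ∀ x, x ∈ S ↔ x ∈ Set.range τ := fun x => Iff.rfl
  have hdense := S.dense_of_no_min (fun hbot => by
      have : τ t ∈ S := (hmem _).mpr ⟨t, rfl⟩
      rw [hbot, AddSubgroup.mem_bot] at this
      exact ht.ne' this) (by
    rintro ⟨a, ⟨haS, ha⟩, hle⟩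
    obtain ⟨u, rfl⟩ := (hmem a).mp haS
    obtain ⟨s, hs, hs'⟩ := hmin u ha
    exact absurd (hle ⟨(hmem _).mpr ⟨s, rfl⟩, hs⟩) (not_le.mpr hs'))
  exact hdense

/-- A group of homeomorphisms of the line normalising a free action by translations with dense
translation numbers is semi-conjugate to an affine group. -/
theorem isSemiconjugateTo_affine {G N : Subgroup (ℝ ≃ₜ ℝ)}
    (hnorm : ∀ g ∈ G, ∀ n ∈ N, g * n * g⁻¹ ∈ N) (hmono : ∀ n ∈ N, StrictMono n)
    (hfree : ∀ n ∈ N, n ≠ 1 → ∀ x, n x ≠ x) {t : ℝ ≃ₜ ℝ} (htN : t ∈ N) (ht : ∀ x, x < t x)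
    (hmin : ∀ t ∈ N, (∀ x, x < t x) → ∃ s ∈ N, ∃ p, p < s p ∧ s p < t p) :
    ∃ F : Subgroup (ℝ ≃ₜ ℝ), (∀ f ∈ F, IsAffineTransformation f) ∧ IsSemiconjugateTo G F := by
  set ρ := ofSubgroup N hmono
  have hfree' : ∀ n : N, n ≠ 1 → ∀ x, ρ n x ≠ x := fun n hn x =>
    hfree n n.2 (fun h => hn (Subtype.ext h)) x
  obtain ⟨τ, hτ, hlt₀⟩ := exists_translation_number hfree' 0
  have hlt : ∀ {a b : N} {x : ℝ}, ρ a x < ρ b x → τ a < τ b := fun h =>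
    hlt₀ _ _ (lt_apply_of_lt_of_free hfree' h 0)
  have hτ1 : τ 1 = 0 := by simpa using hτ 1 1
  have hτpos : ∀ {a : N} {x : ℝ}, x < ρ a x → 0 < τ a := fun {a x} h => by
    rw [← hτ1]; exact hlt (x := x) (by simpa using h)
  have hposτ : ∀ {a : N}, 0 < τ a → ∀ x, x < ρ a x := fun {a} h x => by
    rcases lt_trichotomy x (ρ a x) with h' | h' | h'
    · exact h'
    · by_cases ha : a = 1
      · rw [ha, hτ1] at h; exact absurd h (lt_irrefl _)
      · exact absurd h'.symm (hfree' a ha x)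
    · have := hlt (a := a) (b := 1) (x := x) (by simpa using h')
      rw [hτ1] at this
      exact absurd h this.not_gt
  have hτt : 0 < τ ⟨t, htN⟩ := hτpos (x := 0) (ht 0)
  have hd : DenseRange τ := denseRange_of_no_min hτ hτt fun u hu => by
    obtain ⟨s, hs, p, hp, hp'⟩ := hmin u u.2 (hposτ hu)
    exact ⟨⟨s, hs⟩, hτpos (x := p) hp, hlt (x := p) hp'⟩
  obtain ⟨h, hm, hh⟩ := exists_semiconj_translation hτ hlt₀ (t := ⟨t, htN⟩) ht
  have hdr : DenseRange h := by
    refine dense_of_exists_between fun u v huv => ?_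
    obtain ⟨_, ⟨n, rfl⟩, hn⟩ := hd.exists_between (sub_lt_sub_right huv (h 0))
    exact ⟨h (ρ n 0), ⟨_, rfl⟩, by rw [hh]; linarith [hn.1], by rw [hh]; linarith [hn.2]⟩
  have hcont : Continuous h := hm.continuous_of_denseRange hdr
  have hpow : ∀ k : ℤ, τ (⟨t, htN⟩ ^ k) = k * τ ⟨t, htN⟩ := fun k => by
    have := map_zsmul (AddMonoidHom.mk' (fun x : Additive N => τ x.toMul) (fun x y => hτ _ _)) k
      (Additive.ofMul ⟨t, htN⟩)
    simpa using this
  have htop : Tendsto h atTop atTop := tendsto_atTop_atTop_of_monotone hm fun b => by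
    obtain ⟨k, hk⟩ := exists_int_gt ((b - h 0) / τ ⟨t, htN⟩)
    rw [div_lt_iff₀ hτt] at hk
    exact ⟨ρ (⟨t, htN⟩ ^ k) 0, by rw [hh, hpow]; linarith⟩
  have hbot : Tendsto h atBot atBot := tendsto_atBot_atBot_of_monotone hm fun b => by
    obtain ⟨k, hk⟩ := exists_int_lt ((b - h 0) / τ ⟨t, htN⟩)
    rw [lt_div_iff₀ hτt] at hk
    exact ⟨ρ (⟨t, htN⟩ ^ k) 0, by rw [hh, hpow]; linarith⟩
  have hsurj : Function.Surjective h := hcont.surjective htop hbot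
  have haff : ∀ g : G, ∃ a b : ℝ, a ≠ 0 ∧ ∀ x, h ((g : ℝ ≃ₜ ℝ) x) = a * h x + b := fun g => by
    set σ : N → N := fun n => ⟨g * n * (g : ℝ ≃ₜ ℝ)⁻¹, hnorm g g.2 n n.2⟩ with hσ
    have hσmul : ∀ a b, σ (a * b) = σ a * σ b := fun a b => Subtype.ext (by
      show (g : ℝ ≃ₜ ℝ) * (a * b) * (g : ℝ ≃ₜ ℝ)⁻¹ =
        (g * a * (g : ℝ ≃ₜ ℝ)⁻¹) * (g * b * (g : ℝ ≃ₜ ℝ)⁻¹)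
      group)
    have hσap : ∀ n x, ρ (σ n) ((g : ℝ ≃ₜ ℝ) x) = (g : ℝ ≃ₜ ℝ) (ρ n x) := fun n x => by
      show (g : ℝ ≃ₜ ℝ) (n.1 ((g : ℝ ≃ₜ ℝ).symm ((g : ℝ ≃ₜ ℝ) x))) = _
      rw [Homeomorph.symm_apply_apply]; rfl
    -- Conjugation by `g` preserves or reverses the order on `N`, so it multiplies `τ` by some `a`
    -- of the corresponding sign. Then `a⁻¹ * h ∘ g` is monotone with the same equivariance as `h`,
    -- and differs from it by a constant.
    suffices H : ∃ a : ℝ, a ≠ 0 ∧ (∀ n, τ (σ n) = a * τ n) ∧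
        Monotone fun x => a⁻¹ * h ((g : ℝ ≃ₜ ℝ) x) by
      obtain ⟨a, ha, h1, h2⟩ := H
      have key := sub_eq_sub_of_equivariant hd hm hh h2 (fun n x => by
        rw [← hσap, hh, h1]
        field_simp) 0
      refine ⟨a, a * (a⁻¹ * h ((g : ℝ ≃ₜ ℝ) 0) - h 0), ha, fun x => ?_⟩
      rw [← key x]
      field_simp
      ring
    rcases (g : ℝ ≃ₜ ℝ).continuous.strictMono_of_inj (g : ℝ ≃ₜ ℝ).injective with hg | hg
    · obtain ⟨a, ha, h1⟩ := exists_pos_mul_eq (φ := fun n => τ (σ n)) hτ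
        (fun a b => by rw [hσmul, hτ]) (fun n hn => by
          refine hτpos (x := (g : ℝ ≃ₜ ℝ) 0) ?_
          rw [hσap]
          exact hg (hposτ hn 0)) hτt
      exact ⟨a, ha.ne', h1, fun x y hxy =>
        mul_le_mul_of_nonneg_left (hm (hg.monotone hxy)) (inv_nonneg.mpr ha.le)⟩
    · obtain ⟨a, ha, h1⟩ := exists_pos_mul_eq (φ := fun n => - τ (σ n)) hτ
        (fun a b => by rw [hσmul, hτ]; ring) (fun n hn => by
          have := hlt (a := σ n) (b := 1) (x := (g : ℝ ≃ₜ ℝ) 0) (by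
            rw [hσap, apply_one]
            exact hg (hposτ hn 0))
          rw [hτ1] at this
          linarith) hτt
      refine ⟨-a, neg_ne_zero.mpr ha.ne', fun n => by linarith [h1 n], fun x y hxy => ?_⟩
      have h2 := hm (hg.antitone hxy)
      simp only [inv_neg, neg_mul, neg_le_neg_iff]
      exact mul_le_mul_of_nonneg_left h2 (inv_nonneg.mpr ha.le)
  choose a b ha hab using haff
  have hval : ∀ (g : G) x, ((Homeomorph.mulLeft₀ (a g) (ha g)).trans (Homeomorph.addRight (b g))) x
      = a g * x + b g := fun g x => rfl
  let θ : G →* (ℝ ≃ₜ ℝ) := MonoidHom.mk'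
    (fun g => (Homeomorph.mulLeft₀ (a g) (ha g)).trans (Homeomorph.addRight (b g))) (fun g k => by
      ext y
      -- Surjectivity of `h` reduces the identity to points `h x`, where both sides equal `h` at the
      -- image of `x` under the product.
      obtain ⟨x, rfl⟩ := hsurj y
      rw [Homeomorph.mul_apply]
      rw [hval, hval, hval, ← hab, ← hab, ← hab]
      rfl)
  refine ⟨θ.range, ?_, θ.rangeRestrict, h, θ.rangeRestrict_surjective, hcont, ⟨hm, htop, hbot⟩,
    fun g x => ?_⟩
  · rintro _ ⟨g, rfl⟩
    exact ⟨a g, b g, ha g, hval g⟩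
  · show θ g (h x) = _
    rw [hab]
    rfl

end OrderAction

/-! ### Existence of free elements and the main theorem -/

namespace OrderAction

/-- Without global fixed points, some element moves every point to the right. -/
theorem AtMostTwoFixed.exists_free {Γ X : Type*} [Group Γ] [LinearOrder X] {ρ : Γ →* (X ≃o X)}
    [IsDedekindComplete X] [NoMaxOrder X] [NoMinOrder X] [DenselyOrdered X] [Nonempty X]
    (hρ : AtMostTwoFixed ρ) (hng : ∀ p, ∃ k, ρ k p ≠ p) : ∃ t : Γ, ∀ x, x < ρ t x := by
  by_contra! hcon
  -- If no element is positive everywhere, the signs at the two ends always differ. Any two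
  -- non-trivial elements then share a fixed point, hence all fixed points, producing a global one.
  have hopp : ∀ g : Γ, PosTop ρ g → PosBot ρ g⁻¹ := fun g hg => by
    rcases hρ.isPositiveCone_posBot.tri g with h | h | h
    · exact absurd h (hρ.isPositiveCone_posTop.ne_one hg)
    · obtain ⟨x, hx⟩ := hcon g
      exact absurd (hρ.lt_of_pos hng hg h x) (not_lt.mpr hx)
    · exact h
  obtain ⟨x⟩ := ‹Nonempty X›
  obtain ⟨e, hex⟩ := hng x
  have he : e ≠ 1 := by rintro rfl; simp at hex
  obtain ⟨p, hp, -⟩ := hρ.exists_common_fixed hopp he he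
  obtain ⟨k, hk⟩ := hng p
  have hk1 : k ≠ 1 := by rintro rfl; simp at hk
  obtain ⟨q, hq, hq'⟩ := hρ.exists_common_fixed hopp he hk1
  exact hk (hρ.fixed_of_common he hq hq' hp)

end OrderAction

open OrderAction in
theorem theoremA (G : Subgroup (ℝ ≃ₜ ℝ)) (hG : HasAtMostFixedPoints G 2) :
    ((∀ f ∈ orientationPreserving G, ∀ g ∈ orientationPreserving G, f * g = g * f) ∧
      ∀ g ∈ orientationPreserving G, g ≠ 1 → ∀ x : ℝ, g x = x →
        IsGlobalFixedPoint (orientationPreserving G) x) ∨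
    ∃ F : Subgroup (ℝ ≃ₜ ℝ), (∀ f ∈ F, IsAffineTransformation f) ∧ IsSemiconjugateTo G F := by
  have hmono : ∀ g ∈ orientationPreserving G, StrictMono g := fun g hg => hg.2
  set ρ := ofSubgroup (orientationPreserving G) hmono
  have hρ : AtMostTwoFixed ρ := fun g hg => hG g g.2.1 (fun h => hg (Subtype.ext h))
  by_cases hcomm : ∀ f ∈ orientationPreserving G, ∀ g ∈ orientationPreserving G, f * g = g * f
  · refine Or.inl ⟨hcomm, fun g hg hg1 x hx k hk => ?_⟩
    exact hρ.fixed_of_commute (e := ⟨g, hg⟩) (k := ⟨k, hk⟩)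
      (fun h => hg1 (congrArg Subtype.val h)) (Subtype.ext (hcomm g hg k hk)) hx
  have hcomm' : ¬ ∀ f g : orientationPreserving G, f * g = g * f := fun h =>
    hcomm fun f hf g hg => congrArg Subtype.val (h ⟨f, hf⟩ ⟨g, hg⟩)
  have hng : ∀ p, ∃ k, ρ k p ≠ p := by
    by_contra! hcon
    obtain ⟨p, hp⟩ := hcon
    exact hcomm' (hρ.commute_of_global hp)
  obtain ⟨e, he, x, hex⟩ : ∃ e : orientationPreserving G, e ≠ 1 ∧ ∃ x, ρ e x = x := by
    by_contra! hcon
    exact hcomm' (commute_of_free hcon)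
  obtain ⟨t, ht⟩ := hρ.exists_free hng
  let N : Subgroup (ℝ ≃ₜ ℝ) := Subgroup.map (orientationPreserving G).subtype
    { carrier := {g | IsTranslation ρ g}
      mul_mem' := hρ.isTranslation_mul hng
      one_mem' := Or.inl rfl
      inv_mem' := isTranslation_inv }
  have hmem : ∀ {n}, n ∈ N ↔ ∃ g : orientationPreserving G, IsTranslation ρ g ∧ (g : ℝ ≃ₜ ℝ) = n :=
    Iff.rfl
  refine Or.inr (isSemiconjugateTo_affine (N := N) ?_ ?_ ?_ (t := t)
    (hmem.mpr ⟨t, Or.inr fun x => (ht x).ne', rfl⟩) ht ?_)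
  · intro g hg n hn
    obtain ⟨k, hk, rfl⟩ := hmem.mp hn
    have hgk : g * k * g⁻¹ ∈ orientationPreserving G := by
      refine ⟨G.mul_mem (G.mul_mem hg k.2.1) (G.inv_mem hg), ?_⟩
      have hk2 : StrictMono (k : ℝ ≃ₜ ℝ) := k.2.2
      show StrictMono fun x => g ((k : ℝ ≃ₜ ℝ) (g.symm x))
      rcases g.continuous.strictMono_of_inj g.injective with h | h
      · have hs : StrictMono g.symm := fun x y hxy => by
          rwa [← h.lt_iff_lt, g.apply_symm_apply, g.apply_symm_apply]
        exact h.comp (hk2.comp hs)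
      · have hs : StrictAnti g.symm := fun x y hxy => by
          rwa [← h.lt_iff_gt, g.apply_symm_apply, g.apply_symm_apply]
        exact h.comp (hk2.comp_strictAnti hs)
    refine hmem.mpr ⟨⟨_, hgk⟩, ?_, rfl⟩
    rcases hk with rfl | hk
    · exact Or.inl (Subtype.ext (by simp))
    · refine Or.inr fun y hy => hk (g.symm y) ?_
      exact g.injective ((show g ((k : ℝ ≃ₜ ℝ) (g.symm y)) = y from hy).trans
        (g.apply_symm_apply y).symm)
  · intro n hn
    obtain ⟨k, -, rfl⟩ := hmem.mp hn
    exact k.2.2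
  · intro n hn hn1
    obtain ⟨k, hk, rfl⟩ := hmem.mp hn
    exact hk.resolve_left fun h => hn1 (by rw [h]; rfl)
  · intro n hn hpos
    obtain ⟨k, hk, rfl⟩ := hmem.mp hn
    -- At the largest fixed point `p` of `e`, the point `ρ k p` is moved by `e`. One of `e`, `e⁻¹`
    -- moves it left while fixing `p`, so conjugating `k` by it gives a translation that is shorter
    -- at `p`.
    obtain ⟨p, hp, hmax⟩ := Set.exists_max_image _ id (hρ.finite he) ⟨x, hex⟩
    have hpk : p < ρ k p := hpos p
    have hep : ρ e (ρ k p) ≠ ρ k p := fun h => absurd (hmax _ h) (not_le.mpr hpk)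
    obtain ⟨d, hdp, hdk⟩ : ∃ d : orientationPreserving G, ρ d p = p ∧ ρ d (ρ k p) < ρ k p := by
      rcases lt_or_gt_of_ne hep with h | h
      · exact ⟨e, hp, h⟩
      · exact ⟨e⁻¹, inv_fixed ρ hp, (inv_lt_iff ρ).mpr h⟩
    have hs : ρ (d * k * d⁻¹) p = ρ d (ρ k p) := by
      rw [apply_mul, apply_mul, inv_fixed ρ hdp]
    refine ⟨_, hmem.mpr ⟨d * k * d⁻¹, isTranslation_conj hk d, rfl⟩, p, ?_, ?_⟩
    · show p < ρ (d * k * d⁻¹) p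
      have := (ρ d).strictMono hpk
      rwa [hdp, ← hs] at this
    · show ρ (d * k * d⁻¹) p < ρ k p
      rw [hs]
      exact hdk
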